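/- All manifolds and tensor fields are smooth. A metric g.f.f-structure on a manifold $\bar M^{2n+r}$ consists of a semi-Riemannian metric $\bar g$ of constant index $\nu$, a nowhere vanishing $(1,1)$-tensor field $\bar\varphi$ of constant rank, vector fields $\bar\xi_1,\dots,\bar\xi_r$ spanning $\ker\bar\varphi$ and $1$-forms $\bar\eta^1,\dots,\bar\eta^r$ with $\bar\eta^\alpha(\bar\xi_\beta)=\delta^\alpha_\beta$, $\bar\varphi^2=-I+\sum_\alpha\bar\eta^\alpha\otimes\bar\xi_\alpha$ and $\bar g(\bar\varphi X,\bar\varphi Y)=\bar g(X,Y)-\sum_\alpha\varepsilon_\alpha\bar\eta^\alpha(X)\bar\eta^\alpha(Y)$, where $\varepsilon_\alpha=\bar g(\bar\xi_\alpha,\bar\xi_\alpha)=\pm1$. It is an $\mathcal S$-structure if $d\bar\eta^\alpha(X,Y)=\bar g(X,\bar\varphi Y)$ for every $\alpha$ and $N_{\bar\varphi}+2\sum_\alpha d\bar\eta^\alpha\otimes\bar\xi_\alpha=0$, where $N_{\bar\varphi}$ is the Nijenhuis torsion and $2\,d\eta(X,Y)=X(\eta(Y))-Y(\eta(X))-\eta([X,Y])$;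 it is indefinite if $0<\nu<\dim\bar M$. Let $(\bar M,\bar\varphi,\bar\xi_\alpha,\bar\eta^\alpha,\bar g)$ be an indefinite $\mathcal S$-manifold of dimension $2n+r$, $n\ge 3$, and index $\nu$. Let $M$ be a lightlike (immersed) hypersurface of $\bar M$ to which all $\bar\xi_\alpha$ are tangent, with radical distribution $\mathrm{Rad}(TM)=TM\cap TM^\perp$, and let $S(TM)$ be a characteristic screen distribution, i.e. a distribution with $TM=\mathrm{Rad}(TM)\oplus S(TM)$, $\ker\bar\varphi\subset S(TM)$ and $\bar\varphi(\mathrm{Rad}(TM))\subset S(TM)$. Let $ltr(M)$ be the line bundle along $M$ spanned by the null vectors orthogonal to $S(TM)$ and not orthogonal to $\mathrm{Rad}(TM)$. Let $D_0$ be the orthogonal complement of $\bar\varphi(\mathrm{Rad}(TM))\oplus\bar\varphi(ltr(M))$ in $S(TM)$, and $\mathcal F=(\bar\varphi(\mathrm{Rad}(TM))\oplus\bar\varphi(ltr(M)))\oplus\mathrm{Rad}(TM)$, so that $T\bar M|_M=TM\oplus ltr(M)$ and $TM=D_0\oplus\mathcal F$. Suppose that $D_0$ is integrable (involutive). Then every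 leaf $M_0$ of $D_0$ (indeed every non-empty integral manifold of $D_0$) has dimension $2(n-2)+r$, and the restrictions of $\bar\varphi,\bar\xi_\alpha,\bar\eta^\alpha,\bar g$ form a metric g.f.f-structure on $M_0$ which is an $\mathcal S$-structure, with metric of index $\nu-2$. In particular it is an indefinite $\mathcal S$-structure if and only if $2<\nu<2n+r-2$, that is, unless the restriction of $\bar g$ to $M_0$ is definite. Moreover, let $\bar\nabla$ be the Levi-Civita connection of $\bar M$, let $\nabla$ be the connection induced on $M$ by $\bar\nabla_XY=\nabla_XY+h(X,Y)$ with $h(X,Y)\in ltr(M)$, and let $\overset{\circ}{\nabla}$ be the connection induced on $M_0$ by $\nabla_XY=\overset{\circ}{\nabla}_XY+\overset{\circ}{h}(X,Y)$ with $\overset{\circ}{\nabla}_XY\in D_0$ and $\overset{\circ}{h}(X,Y)\in\mathcal F$, for vector fields $X,Y$ tangent to $M_0$. Both connections exist, and $\overset{\circ}{\nabla}$ is the Levi-Civita connection of $M_0$. -/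

import Mathlib

open Bundle
open scoped Manifold ContDiff Topology

noncomputable section

namespace LightlikeGFF

section Manifolds

variable {m : ℕ} {M : Type*} [TopologicalSpace M]
  [ChartedSpace (EuclideanSpace ℝ (Fin m)) M]

/-- `ν` is the index of the symmetric bilinear form `b`: the largest dimension of a subspace on
which `b` is negative definite. -/
def IsIndexOf {V : Type*} [AddCommGroup V] [Module ℝ V] (b : V → V → ℝ) (ν : ℕ) : Prop :=
  IsGreatest {k : ℕ | ∃ W : Submodule ℝ V, Module.finrank ℝ W = k ∧
    ∀ w ∈ W, w ≠ 0 → b w w < 0} ν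

/-- `dη (X, Y)` at `x`, for a one-form `η` and vector fields `X`, `Y`, with the normalisation
`2 dη (X, Y) = X (η Y) - Y (η X) - η [X, Y]`, the one for which an `S`-structure satisfies both
`dη = Φ` and the normality condition `N_φ + 2 dη ⊗ ξ = 0`. -/
def dOneForm (η : ∀ x : M, TangentSpace (𝓡 m) x →L[ℝ] ℝ)
    (X Y : ∀ x : M, TangentSpace (𝓡 m) x) (x : M) : ℝ :=
  (1 / 2 : ℝ) * (mvfderiv (𝓡 m) (fun y => η y (Y y)) x (X x)
    - mvfderiv (𝓡 m) (fun y => η y (X y)) x (Y x)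
    - η x (VectorField.mlieBracket (𝓡 m) X Y x))

/-- The Nijenhuis torsion
`N_φ (X, Y) = φ² [X, Y] + [φ X, φ Y] - φ [φ X, Y] - φ [X, φ Y]` at `x`. -/
def nijenhuis (φ : ∀ x : M, TangentSpace (𝓡 m) x →L[ℝ] TangentSpace (𝓡 m) x)
    (X Y : ∀ x : M, TangentSpace (𝓡 m) x) (x : M) : TangentSpace (𝓡 m) x :=
  φ x (φ x (VectorField.mlieBracket (𝓡 m) X Y x))
    + VectorField.mlieBracket (𝓡 m) (fun y => φ y (X y)) (fun y => φ y (Y y)) x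
    - φ x (VectorField.mlieBracket (𝓡 m) (fun y => φ y (X y)) Y x)
    - φ x (VectorField.mlieBracket (𝓡 m) X (fun y => φ y (Y y)) x)

/-- An integral manifold of the distribution `Δ`: an injectively immersed manifold `ι : L → M`
whose tangent spaces are the subspaces `Δ`. The leaves of an integrable distribution are its
maximal connected integral manifolds. -/
structure IsIntegralManifold {d : ℕ} {L : Type*} [TopologicalSpace L]
    [ChartedSpace (EuclideanSpace ℝ (Fin d)) L]
    (Δ : ∀ p : M, Submodule ℝ (TangentSpace (𝓡 m) p)) (ι : L → M) : Prop where
  immersion : Manifold.IsImmersion (𝓡 d) (𝓡 m) ∞ ι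
  injective : Function.Injective ι
  range_mfderiv : ∀ q : L, (mfderiv (𝓡 d) (𝓡 m) ι q).range = Δ (ι q)

variable [IsManifold (𝓡 m) ∞ M]

/-- A smooth distribution of rank `k`: near every point it is spanned by `k` linearly independent
smooth vector fields. -/
def IsSmoothDistribution (Δ : ∀ p : M, Submodule ℝ (TangentSpace (𝓡 m) p)) (k : ℕ) : Prop :=
  ∀ p : M, ∃ U : Set M, IsOpen U ∧ p ∈ U ∧
    ∃ X : Fin k → ∀ q : M, TangentSpace (𝓡 m) q,
      (∀ i, ContMDiffOn (𝓡 m) (𝓡 m).tangent ∞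
        (fun q => (⟨q, X i q⟩ : TangentBundle (𝓡 m) M)) U) ∧
      ∀ q ∈ U, LinearIndependent ℝ (fun i => X i q) ∧
        Submodule.span ℝ (Set.range fun i => X i q) = Δ q

/-- Integrability (involutivity) of a distribution: the bracket of two local smooth sections is
again a section. -/
def IsIntegrable (Δ : ∀ p : M, Submodule ℝ (TangentSpace (𝓡 m) p)) : Prop :=
  ∀ (U : Set M), IsOpen U → ∀ X Y : ∀ q : M, TangentSpace (𝓡 m) q,
    ContMDiffOn (𝓡 m) (𝓡 m).tangent ∞ (fun q => (⟨q, X q⟩ : TangentBundle (𝓡 m) M)) U →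
    ContMDiffOn (𝓡 m) (𝓡 m).tangent ∞ (fun q => (⟨q, Y q⟩ : TangentBundle (𝓡 m) M)) U →
    (∀ q ∈ U, X q ∈ Δ q) → (∀ q ∈ U, Y q ∈ Δ q) →
    ∀ q ∈ U, VectorField.mlieBracket (𝓡 m) X Y q ∈ Δ q

variable (m M) in
/-- A semi-Riemannian metric: a smooth symmetric non-degenerate `(0,2)`-tensor field of constant
index. -/
structure SemiRiemannianMetric where
  inner : ∀ x : M, TangentSpace (𝓡 m) x →L[ℝ] TangentSpace (𝓡 m) x →L[ℝ] ℝ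
  symm : ∀ (x : M) (v w : TangentSpace (𝓡 m) x), inner x v w = inner x w v
  nondegenerate : ∀ (x : M) (v : TangentSpace (𝓡 m) x), (∀ w, inner x v w = 0) → v = 0
  contMDiff : ContMDiff (𝓡 m)
    ((𝓡 m).prod 𝓘(ℝ, EuclideanSpace ℝ (Fin m) →L[ℝ] EuclideanSpace ℝ (Fin m) →L[ℝ] ℝ)) ∞
    (fun x => TotalSpace.mk'
      (EuclideanSpace ℝ (Fin m) →L[ℝ] EuclideanSpace ℝ (Fin m) →L[ℝ] ℝ) x (inner x))
  index : ℕ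
  isIndexOf : ∀ x : M, IsIndexOf (fun v w => inner x v w) index

/-- `cov` is the Levi-Civita connection of `g`: it is torsion-free and metric. -/
def IsLeviCivita (g : SemiRiemannianMetric m M)
    (cov : CovariantDerivative (𝓡 m) (EuclideanSpace ℝ (Fin m))
      (TangentSpace (𝓡 m) : M → Type _)) : Prop :=
  cov.torsion = 0 ∧
  ∀ (x : M) (Y Z : ∀ y : M, TangentSpace (𝓡 m) y),
    MDifferentiableAt (𝓡 m) (𝓡 m).tangent (fun y => (⟨y, Y y⟩ : TangentBundle (𝓡 m) M)) x →
    MDifferentiableAt (𝓡 m) (𝓡 m).tangent (fun y => (⟨y, Z y⟩ : TangentBundle (𝓡 m) M)) x →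
    ∀ X : TangentSpace (𝓡 m) x,
      mvfderiv (𝓡 m) (fun y => g.inner y (Y y) (Z y)) x X =
        g.inner x (cov Y x X) (Z x) + g.inner x (Y x) (cov Z x X)

variable (m M) in
/-- A globally framed `f`-structure `(φ, ξ_α, η^α)`, `α = 1, …, r`, together with a compatible
semi-Riemannian metric; `ε α = ± 1` according to whether `ξ_α` is spacelike or timelike. -/
structure MetricGFF (r : ℕ) extends SemiRiemannianMetric m M where
  φ : ∀ x : M, TangentSpace (𝓡 m) x →L[ℝ] TangentSpace (𝓡 m) x
  ξ : Fin r → ∀ x : M, TangentSpace (𝓡 m) x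
  η : Fin r → ∀ x : M, TangentSpace (𝓡 m) x →L[ℝ] ℝ
  ε : Fin r → ℝ
  φ_contMDiff : ContMDiff (𝓡 m)
    ((𝓡 m).prod 𝓘(ℝ, EuclideanSpace ℝ (Fin m) →L[ℝ] EuclideanSpace ℝ (Fin m))) ∞
    (fun x => TotalSpace.mk' (EuclideanSpace ℝ (Fin m) →L[ℝ] EuclideanSpace ℝ (Fin m)) x (φ x))
  ξ_contMDiff : ∀ α, ContMDiff (𝓡 m) (𝓡 m).tangent ∞
    (fun x => (⟨x, ξ α x⟩ : TangentBundle (𝓡 m) M))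
  η_contMDiff : ∀ α, ContMDiff (𝓡 m) ((𝓡 m).prod 𝓘(ℝ, EuclideanSpace ℝ (Fin m) →L[ℝ] ℝ)) ∞
    (fun x => TotalSpace.mk' (EuclideanSpace ℝ (Fin m) →L[ℝ] ℝ) x (η α x))
  φ_ne_zero : ∀ x, φ x ≠ 0
  φ_constant_rank : ∃ k : ℕ, ∀ x, Module.finrank ℝ (φ x).range = k
  ker_φ : ∀ x, (φ x).ker = Submodule.span ℝ (Set.range fun α => ξ α x)
  η_ξ : ∀ α β x, η α x (ξ β x) = if α = β then 1 else 0
  φ_sq : ∀ x v, φ x (φ x v) = -v + ∑ α, η α x v • ξ α x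
  ε_sign : ∀ α, ε α = 1 ∨ ε α = -1
  inner_ξ : ∀ α x, inner x (ξ α x) (ξ α x) = ε α
  compatible : ∀ x v w,
    inner x (φ x v) (φ x w) = inner x v w - ∑ α, ε α * η α x v * η α x w

namespace MetricGFF

variable {r : ℕ}

/-- The structure is indefinite: the index of the metric lies strictly between `0` and the
dimension. -/
def IsIndefinite (S : MetricGFF m M r) : Prop := 0 < S.index ∧ S.index < m

/-- An `S`-structure: `dη^α = Φ` for every `α`, where `Φ (X, Y) = g (X, φ Y)`, and the structure
is normal, i.e. `N_φ + 2 dη^α ⊗ ξ_α = 0`. -/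
def IsSStructure (S : MetricGFF m M r) : Prop :=
  ∀ (x : M) (X Y : ∀ y : M, TangentSpace (𝓡 m) y),
    MDifferentiableAt (𝓡 m) (𝓡 m).tangent (fun y => (⟨y, X y⟩ : TangentBundle (𝓡 m) M)) x →
    MDifferentiableAt (𝓡 m) (𝓡 m).tangent (fun y => (⟨y, Y y⟩ : TangentBundle (𝓡 m) M)) x →
    (∀ α, dOneForm (S.η α) X Y x = S.inner x (X x) (S.φ x (Y x))) ∧
    nijenhuis S.φ X Y x + ∑ α, (2 * dOneForm (S.η α) X Y x) • S.ξ α x = 0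

/-- An indefinite `S`-structure. -/
def IsIndefiniteSStructure (S : MetricGFF m M r) : Prop := S.IsIndefinite ∧ S.IsSStructure

end MetricGFF

end Manifolds

section Induced

variable {d m r : ℕ}
  {L : Type*} [TopologicalSpace L] [ChartedSpace (EuclideanSpace ℝ (Fin d)) L]
  [IsManifold (𝓡 d) ∞ L]
  {M : Type*} [TopologicalSpace M] [ChartedSpace (EuclideanSpace ℝ (Fin m)) M]
  [IsManifold (𝓡 m) ∞ M]

/-- The structure `T` on `L` consists of the restrictions along the immersion `f : L → M` of the
tensors `g, φ, ξ_α, η^α` (and the signs `ε_α`) of the structure `S` on `M`. -/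
structure IsRestriction (f : L → M) (S : MetricGFF m M r) (T : MetricGFF d L r) : Prop where
  inner : ∀ x v w, T.inner x v w =
    S.inner (f x) (mfderiv (𝓡 d) (𝓡 m) f x v) (mfderiv (𝓡 d) (𝓡 m) f x w)
  φ : ∀ x v, mfderiv (𝓡 d) (𝓡 m) f x (T.φ x v) = S.φ (f x) (mfderiv (𝓡 d) (𝓡 m) f x v)
  ξ : ∀ α x, mfderiv (𝓡 d) (𝓡 m) f x (T.ξ α x) = S.ξ α (f x)
  η : ∀ α x v, T.η α x v = S.η α (f x) (mfderiv (𝓡 d) (𝓡 m) f x v)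
  ε : T.ε = S.ε

/-- Gauss equation. Given an immersion `f : L → M`, subspaces `K x ⊆ T_{f x} M` complementary to
the tangent spaces of `L`, and a connection `covM` on `M`, the connection `covL` on `L` is the one
induced by `covM`: for every vector field `Y` on `L`, every vector field `Z` on `M` extending `Y`
near `x`, and every `X ∈ T_x L`,
`covM_X Z = covL_X Y + h (X, Y)` with `h (X, Y) ∈ K x`. -/
def IsInducedConnection (f : L → M) (K : ∀ x : L, Submodule ℝ (TangentSpace (𝓡 m) (f x)))
    (covM : CovariantDerivative (𝓡 m) (EuclideanSpace ℝ (Fin m))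
      (TangentSpace (𝓡 m) : M → Type _))
    (covL : CovariantDerivative (𝓡 d) (EuclideanSpace ℝ (Fin d))
      (TangentSpace (𝓡 d) : L → Type _)) : Prop :=
  ∀ (x : L) (Y : ∀ y : L, TangentSpace (𝓡 d) y) (Z : ∀ z : M, TangentSpace (𝓡 m) z),
    MDifferentiableAt (𝓡 d) (𝓡 d).tangent (fun y => (⟨y, Y y⟩ : TangentBundle (𝓡 d) L)) x →
    MDifferentiableAt (𝓡 m) (𝓡 m).tangent (fun z => (⟨z, Z z⟩ : TangentBundle (𝓡 m) M)) (f x) →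
    (∀ᶠ y in 𝓝 x, Z (f y) = mfderiv (𝓡 d) (𝓡 m) f y (Y y)) →
    ∀ X : TangentSpace (𝓡 d) x,
      covM Z (f x) (mfderiv (𝓡 d) (𝓡 m) f x X) - mfderiv (𝓡 d) (𝓡 m) f x (covL Y x X) ∈ K x

end Induced

section Hypersurface

/-! In this section `j : M → N` is an immersed hypersurface of the manifold `N` and `S` is a
compatible metric globally framed `f`-structure on `N`. -/

variable {k m r : ℕ}
  {N : Type*} [TopologicalSpace N] [ChartedSpace (EuclideanSpace ℝ (Fin k)) N]
  [IsManifold (𝓡 k) ∞ N]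
  {M : Type*} [TopologicalSpace M] [ChartedSpace (EuclideanSpace ℝ (Fin m)) M]

/-- The radical `Rad (T_p M)` of the induced form on `T_p M`. -/
def radical (g : SemiRiemannianMetric k N) (j : M → N) (p : M) :
    Submodule ℝ (TangentSpace (𝓡 m) p) where
  carrier := {v | ∀ w : TangentSpace (𝓡 m) p,
    g.inner (j p) (mfderiv (𝓡 m) (𝓡 k) j p v) (mfderiv (𝓡 m) (𝓡 k) j p w) = 0}
  zero_mem' := by intro w; simp
  add_mem' := by intro a b ha hb w; simp [ha w, hb w]
  smul_mem' := by intro c a ha w; simp [ha w]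

/-- `j : M → N` is a lightlike hypersurface: an immersion of codimension one such that the induced
form is degenerate at every point. -/
structure IsLightlikeHypersurface (g : SemiRiemannianMetric k N) (j : M → N) : Prop where
  codim : m + 1 = k
  immersion : Manifold.IsImmersion (𝓡 m) (𝓡 k) ∞ j
  degenerate : ∀ p : M, radical (m := m) g j p ≠ ⊥

/-- A characteristic lightlike hypersurface: all `ξ_α` are tangent to it. -/
structure IsCharacteristicHypersurface (S : MetricGFF k N r) (j : M → N) : Prop
    extends IsLightlikeHypersurface (m := m) S.toSemiRiemannianMetric j where
  ξ_tangent : ∀ α (p : M), S.ξ α (j p) ∈ (mfderiv (𝓡 m) (𝓡 k) j p).range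

variable [IsManifold (𝓡 m) ∞ M] in
/-- A characteristic screen distribution `Sc`: a smooth distribution complementary to the radical
distribution, with `ker φ ⊆ Sc` and `φ (Rad TM) ⊆ Sc`. -/
structure IsCharacteristicScreen (S : MetricGFF k N r) (j : M → N)
    (Sc : ∀ p : M, Submodule ℝ (TangentSpace (𝓡 m) p)) : Prop where
  smooth : ∃ s : ℕ, IsSmoothDistribution Sc s
  isCompl : ∀ p, IsCompl (radical S.toSemiRiemannianMetric j p) (Sc p)
  ker_φ : ∀ p, (S.φ (j p)).ker ≤ (Sc p).map (mfderiv (𝓡 m) (𝓡 k) j p).toLinearMap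
  φ_radical : ∀ p, ∀ e ∈ radical S.toSemiRiemannianMetric j p,
    S.φ (j p) (mfderiv (𝓡 m) (𝓡 k) j p e) ∈
      (Sc p).map (mfderiv (𝓡 m) (𝓡 k) j p).toLinearMap

/-- The fibre at `p` of the lightlike transversal bundle `ltr (M)` of the screen distribution `Sc`:
the line spanned by the vectors `ν ∈ T_{j p} N` with `g (ν, ν) = 0`, `g (ν, W) = 0` for all
`W ∈ Sc p`, and `g (ν, e) = 1` for some `e ∈ Rad (T_p M)`. -/
def ltr (g : SemiRiemannianMetric k N) (j : M → N)
    (Sc : ∀ p : M, Submodule ℝ (TangentSpace (𝓡 m) p)) (p : M) :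
    Submodule ℝ (TangentSpace (𝓡 k) (j p)) :=
  Submodule.span ℝ {ν | g.inner (j p) ν ν = 0 ∧
    (∀ w ∈ Sc p, g.inner (j p) ν (mfderiv (𝓡 m) (𝓡 k) j p w) = 0) ∧
    ∃ e ∈ radical g j p, g.inner (j p) ν (mfderiv (𝓡 m) (𝓡 k) j p e) = 1}

/-- `φ (Rad TM) ⊕ φ (ltr M)` at `p`. -/
def phiPlane (S : MetricGFF k N r) (j : M → N)
    (Sc : ∀ p : M, Submodule ℝ (TangentSpace (𝓡 m) p)) (p : M) :
    Submodule ℝ (TangentSpace (𝓡 k) (j p)) :=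
  ((radical S.toSemiRiemannianMetric j p).map (mfderiv (𝓡 m) (𝓡 k) j p).toLinearMap ⊔
    ltr S.toSemiRiemannianMetric j Sc p).map (S.φ (j p)).toLinearMap

/-- The distribution `D₀` on `M`: the orthogonal complement of `φ (Rad TM) ⊕ φ (ltr M)` in the
screen distribution. -/
def distD₀ (S : MetricGFF k N r) (j : M → N)
    (Sc : ∀ p : M, Submodule ℝ (TangentSpace (𝓡 m) p)) (p : M) :
    Submodule ℝ (TangentSpace (𝓡 m) p) where
  carrier := {v | v ∈ Sc p ∧
    ∀ w ∈ phiPlane S j Sc p, S.inner (j p) (mfderiv (𝓡 m) (𝓡 k) j p v) w = 0}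
  zero_mem' := ⟨zero_mem _, by intro w _; simp⟩
  add_mem' := by
    rintro a b ⟨ha, ha'⟩ ⟨hb, hb'⟩
    exact ⟨add_mem ha hb, fun w hw => by simp [ha' w hw, hb' w hw]⟩
  smul_mem' := by
    rintro c a ⟨ha, ha'⟩
    exact ⟨Submodule.smul_mem _ c ha, fun w hw => by simp [ha' w hw]⟩

/-- The distribution `F = (φ (Rad TM) ⊕ φ (ltr M)) ⊥ Rad TM` on `M`, complementary to `D₀`. -/
def distF (S : MetricGFF k N r) (j : M → N)
    (Sc : ∀ p : M, Submodule ℝ (TangentSpace (𝓡 m) p)) (p : M) :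
    Submodule ℝ (TangentSpace (𝓡 m) p) :=
  (phiPlane S j Sc p).comap (mfderiv (𝓡 m) (𝓡 k) j p).toLinearMap ⊔
    radical S.toSemiRiemannianMetric j p

end Hypersurface

end LightlikeGFF

end

noncomputable section

namespace LightlikeGFF

/-! ### Derivatives of functions along smooth maps. -/

section Derivatives

variable {m : ℕ} {M : Type*} [TopologicalSpace M]
  [ChartedSpace (EuclideanSpace ℝ (Fin m)) M]
  {F : Type*} [NormedAddCommGroup F] [NormedSpace ℝ F]

/-! The core is linear algebra at one point. A generator `E` of the radical has a null partner `ν`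
in `ltr (M)` with `g (E, ν) = 1`, orthogonal to the screen. Compatibility makes `φ` skew for `g`,
and isometric on vectors orthogonal to `ker φ`. Since the screen contains `ker φ` and `φ E`, the
pair `φ E`, `φ ν` is again hyperbolic and is orthogonal to `E`, `ν` (`exists_isLightlikeFrame`). The
screen is the orthogonal complement of `E`, `ν`, so `D₀` is the orthogonal complement in the ambient
tangent space of two orthogonal hyperbolic planes (`IsFrameAt.map_distD₀`).

Hence `D₀` has codimension four and is non-degenerate. Its index is two less, as each hyperbolic
plane carries exactly one negative direction (`index_perp₂_perp₂`). It contains every `ξ_α`, since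
`ξ_α` lies in the screen and is orthogonal to the image of `φ`. It is `φ`-invariant, since up to
sign and terms in the `ξ_α` the map `φ` interchanges the two planes.

An integral manifold is therefore a non-degenerate `φ`-invariant submanifold tangent to the `ξ_α`,
and all tensors restrict to it (`HasRetractions.exists_isRestriction`). The `S`-equations involve
only derivatives of functions and brackets of vector fields. Both are compatible with extending
fields from a submanifold (`mfderiv_mlieBracket`), so the equations restrict as well.

For the connections, `F` and `ltr (M)` are both orthogonal to `D₀`. Inducing first on `M` and then
on the leaf thus projects the ambient derivative orthogonally onto the leaf. The orthogonal
projection of a Levi-Civita connection to a non-degenerate submanifold is Levi-Civita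
(`HasRetractions.isLeviCivita`). -/

lemma mvfderiv_congr {x : M} {h h' : M → F} (e : ∀ᶠ y in 𝓝 x, h y = h' y) :
    mvfderiv (𝓡 m) h x = mvfderiv (𝓡 m) h' x := by
  have : mfderiv (𝓡 m) 𝓘(ℝ, F) h x = mfderiv (𝓡 m) 𝓘(ℝ, F) h' x :=
    Filter.EventuallyEq.mfderiv_eq e
  ext v
  exact congrArg (fun A => A v) this

variable {d : ℕ} {L : Type*} [TopologicalSpace L]
  [ChartedSpace (EuclideanSpace ℝ (Fin d)) L]

lemma mvfderiv_comp_apply' {f : L → M} {x : L} {h : M → F}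
    (hh : MDifferentiableAt (𝓡 m) 𝓘(ℝ, F) h (f x)) (hf : MDifferentiableAt (𝓡 d) (𝓡 m) f x)
    (v : TangentSpace (𝓡 d) x) :
    mvfderiv (𝓡 d) (fun y => h (f y)) x v =
      mvfderiv (𝓡 m) h (f x) (mfderiv (𝓡 d) (𝓡 m) f x v) :=
  mfderiv_comp_apply x hh hf v

end Derivatives

/-! ### Lie brackets in charts and related vector fields. -/

section Brackets

open VectorField

variable {m : ℕ} {M : Type*} [TopologicalSpace M]
  [ChartedSpace (EuclideanSpace ℝ (Fin m)) M] [IsManifold (𝓡 m) ∞ M]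
  {F : Type*} [NormedAddCommGroup F] [NormedSpace ℝ F]

/-- The representative of a vector field in the preferred chart at `x`. -/
def chartField (x : M) (X : ∀ y : M, TangentSpace (𝓡 m) y) :
    EuclideanSpace ℝ (Fin m) → EuclideanSpace ℝ (Fin m) :=
  mpullbackWithin 𝓘(ℝ, EuclideanSpace ℝ (Fin m)) (𝓡 m) (extChartAt (𝓡 m) x).symm X
    (Set.range (𝓡 m))

lemma chartField_extChartAt {x y : M} (X : ∀ y : M, TangentSpace (𝓡 m) y)
    (hy : y ∈ (extChartAt (𝓡 m) x).source) :
    chartField x X (extChartAt (𝓡 m) x y) = mvfderiv (𝓡 m) (extChartAt (𝓡 m) x) y (X y) := by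
  have hy' := (extChartAt (𝓡 m) x).map_source hy
  have hinv := isInvertible_mfderivWithin_extChartAt_symm (I := 𝓡 m) hy'
  have h1 := mfderiv_extChartAt_comp_mfderivWithin_extChartAt_symm (I := 𝓡 m) hy'
  have h2 := mfderivWithin_extChartAt_symm_comp_mfderiv_extChartAt (I := 𝓡 m) hy'
  have h3 := ContinuousLinearMap.inverse_eq h2 h1
  change (mfderivWithin _ _ _ _ _).inverse (X ((extChartAt (𝓡 m) x).symm _)) = _
  rw [h3, (extChartAt (𝓡 m) x).left_inv hy]
  rfl

lemma differentiableAt_chartField {x : M} {X : ∀ y : M, TangentSpace (𝓡 m) y}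
    (hX : MDifferentiableAt (𝓡 m) (𝓡 m).tangent
      (fun y => (⟨y, X y⟩ : TangentBundle (𝓡 m) M)) x) :
    DifferentiableAt ℝ (chartField x X) (extChartAt (𝓡 m) x x) := by
  have h := MDifferentiableWithinAt.differentiableWithinAt_mpullbackWithin_vectorField
    (s := Set.univ) hX.mdifferentiableWithinAt
  rw [Set.preimage_univ, Set.univ_inter] at h
  exact h.differentiableAt (by simp [Filter.univ_mem])

lemma mvfderiv_comp_extChartAt {x y : M} {k : EuclideanSpace ℝ (Fin m) → F}
    (hk : DifferentiableAt ℝ k (extChartAt (𝓡 m) x y))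
    (hy : y ∈ (extChartAt (𝓡 m) x).source) (v : TangentSpace (𝓡 m) y) :
    mvfderiv (𝓡 m) (fun z => k (extChartAt (𝓡 m) x z)) y v =
      fderiv ℝ k (extChartAt (𝓡 m) x y) (mvfderiv (𝓡 m) (extChartAt (𝓡 m) x) y v) := by
  have hφ : MDifferentiableAt (𝓡 m) 𝓘(ℝ, EuclideanSpace ℝ (Fin m)) (extChartAt (𝓡 m) x) y :=
    mdifferentiableAt_extChartAt (by simpa using hy)
  have h := mfderiv_comp_apply y hk.mdifferentiableAt hφ v
  rw [mfderiv_eq_fderiv] at h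
  exact h

/-- In a chart the iterated derivative of `k` along `Z` and then `W` is `D²k (W, Z) + Dk (DZ W)`.
Antisymmetrising cancels the symmetric second derivative and leaves `Dk` of the bracket. Vector
values are allowed so that `h` can be a chart, whose derivative separates tangent vectors. -/
lemma mvfderiv_mlieBracket {x : M} {h : M → F}
    (hh : ContMDiffAt (𝓡 m) 𝓘(ℝ, F) ∞ h x) {X Y : ∀ y : M, TangentSpace (𝓡 m) y}
    (hX : MDifferentiableAt (𝓡 m) (𝓡 m).tangent
      (fun y => (⟨y, X y⟩ : TangentBundle (𝓡 m) M)) x)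
    (hY : MDifferentiableAt (𝓡 m) (𝓡 m).tangent
      (fun y => (⟨y, Y y⟩ : TangentBundle (𝓡 m) M)) x) :
    mvfderiv (𝓡 m) h x (mlieBracket (𝓡 m) X Y x) =
      mvfderiv (𝓡 m) (fun y => mvfderiv (𝓡 m) h y (Y y)) x (X x) -
        mvfderiv (𝓡 m) (fun y => mvfderiv (𝓡 m) h y (X y)) x (Y x) := by
  set φ := extChartAt (𝓡 m) x with hφ
  have hx : x ∈ φ.source := mem_extChartAt_source x
  set k : EuclideanSpace ℝ (Fin m) → F := fun u => h (φ.symm u) with hk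
  have hkd : ContDiffAt ℝ ∞ k (φ x) := by
    have := (contMDiffAt_iff.1 hh).2
    exact this.contDiffAt (by simp [Filter.univ_mem])
  have hsrc : ∀ᶠ y in 𝓝 x, y ∈ φ.source := extChartAt_source_mem_nhds x
  have hcont : ContinuousAt φ x := continuousAt_extChartAt x
  have hkev : ∀ᶠ u in 𝓝 (φ x), DifferentiableAt ℝ k u :=
    ((hkd.of_le (m := 1) (WithTop.coe_le_coe.2 le_top)).eventually (by simp)).mono
      fun u hu => hu.differentiableAt (by simp)
  have hhk : ∀ᶠ y in 𝓝 x, h y = k (φ y) := by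
    filter_upwards [hsrc] with y hy
    simp [hk, φ.left_inv hy]
  have hder : ∀ Z : ∀ y : M, TangentSpace (𝓡 m) y,
      ∀ᶠ y in 𝓝 x, mvfderiv (𝓡 m) h y (Z y) =
        fderiv ℝ k (φ y) (chartField x Z (φ y)) := by
    intro Z
    filter_upwards [hsrc, hhk.eventually_nhds, hcont.eventually hkev] with y hy hy1 hy2
    have e1 : mvfderiv (𝓡 m) h y = mvfderiv (𝓡 m) (fun z => k (φ z)) y  :=
      mvfderiv_congr hy1
    rw [e1, mvfderiv_comp_extChartAt hy2 hy, ← chartField_extChartAt Z hy]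
  have hd : ∀ (Z W : ∀ y : M, TangentSpace (𝓡 m) y),
      DifferentiableAt ℝ (chartField x Z) (φ x) →
      mvfderiv (𝓡 m) (fun y => mvfderiv (𝓡 m) h y (Z y)) x (W x) =
        fderiv ℝ (fderiv ℝ k) (φ x) (chartField x W (φ x)) (chartField x Z (φ x)) +
        fderiv ℝ k (φ x) (fderiv ℝ (chartField x Z) (φ x) (chartField x W (φ x))) := by
    intro Z W hZ
    have hk1 : DifferentiableAt ℝ (fderiv ℝ k) (φ x) :=
      (hkd.fderiv_right (m := 1) (WithTop.coe_le_coe.2 le_top)).differentiableAt (by simp)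
    have e1 : mvfderiv (𝓡 m) (fun y => mvfderiv (𝓡 m) h y (Z y)) x =
        mvfderiv (𝓡 m) (fun y => (fun u => fderiv ℝ k u (chartField x Z u)) (φ y)) x  :=
      mvfderiv_congr (hder Z)
    rw [e1, mvfderiv_comp_extChartAt (k := fun u => fderiv ℝ k u (chartField x Z u))
      (hk1.clm_apply hZ) hx, fderiv_clm_apply hk1 hZ, ← chartField_extChartAt W hx]
    simp [add_comm, hφ]
  have hbr : mvfderiv (𝓡 m) φ x (mlieBracket (𝓡 m) X Y x) =
      lieBracket ℝ (chartField x X) (chartField x Y) (φ x) := by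
    have hinv := isInvertible_mfderiv_extChartAt (I := 𝓡 m) hx
    have : mlieBracket (𝓡 m) X Y x = (mfderiv (𝓡 m) 𝓘(ℝ, EuclideanSpace ℝ (Fin m)) φ x).inverse
        (lieBracket ℝ (chartField x X) (chartField x Y) (φ x)) := by
      rw [← mlieBracketWithin_univ, mlieBracketWithin_apply]
      have hr : ((extChartAt (𝓡 m) x).symm ⁻¹' Set.univ ∩ Set.range (𝓡 m)) = Set.univ := by simp
      have hl : lieBracketWithin ℝ (chartField x X) (chartField x Y) Set.univ (φ x) =
          lieBracket ℝ (chartField x X) (chartField x Y) (φ x) := by rw [lieBracketWithin_univ]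
      rw [hr]
      change (mfderiv (𝓡 m) 𝓘(ℝ, EuclideanSpace ℝ (Fin m)) φ x).inverse
        (lieBracketWithin ℝ (chartField x X) (chartField x Y) Set.univ (φ x)) = _
      exact congrArg _ hl
    rw [this]
    exact DFunLike.congr_fun hinv.self_comp_inverse _
  rw [hd Y X (differentiableAt_chartField hY), hd X Y (differentiableAt_chartField hX)]
  have hsymm : IsSymmSndFDerivAt ℝ k (φ x) := hkd.isSymmSndFDerivAt (by simpa using WithTop.coe_le_coe.2 (le_top : (2 : ℕ∞) ≤ ⊤))
  rw [hsymm.eq (chartField x X (φ x)) (chartField x Y (φ x)), add_sub_add_left_eq_sub, ← map_sub]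
  have e1 : mvfderiv (𝓡 m) h x = mvfderiv (𝓡 m) (fun z => k (φ z)) x :=
    mvfderiv_congr hhk
  rw [e1, mvfderiv_comp_extChartAt hkev.self_of_nhds hx, hbr]
  rfl

variable {d : ℕ} {L : Type*} [TopologicalSpace L]
  [ChartedSpace (EuclideanSpace ℝ (Fin d)) L]

variable [IsManifold (𝓡 d) ∞ L]

/-- Lie brackets of `f`-related vector fields are `f`-related. -/
lemma mfderiv_mlieBracket {f : L → M} {x : L} (hf : ContMDiffAt (𝓡 d) (𝓡 m) ∞ f x)
    {X Y : ∀ y : L, TangentSpace (𝓡 d) y} {X' Y' : ∀ y : M, TangentSpace (𝓡 m) y}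
    (hX : MDifferentiableAt (𝓡 d) (𝓡 d).tangent
      (fun y => (⟨y, X y⟩ : TangentBundle (𝓡 d) L)) x)
    (hY : MDifferentiableAt (𝓡 d) (𝓡 d).tangent
      (fun y => (⟨y, Y y⟩ : TangentBundle (𝓡 d) L)) x)
    (hX' : MDifferentiableAt (𝓡 m) (𝓡 m).tangent
      (fun y => (⟨y, X' y⟩ : TangentBundle (𝓡 m) M)) (f x))
    (hY' : MDifferentiableAt (𝓡 m) (𝓡 m).tangent
      (fun y => (⟨y, Y' y⟩ : TangentBundle (𝓡 m) M)) (f x))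
    (eX : ∀ᶠ y in 𝓝 x, X' (f y) = mfderiv (𝓡 d) (𝓡 m) f y (X y))
    (eY : ∀ᶠ y in 𝓝 x, Y' (f y) = mfderiv (𝓡 d) (𝓡 m) f y (Y y)) :
    mfderiv (𝓡 d) (𝓡 m) f x (mlieBracket (𝓡 d) X Y x) = mlieBracket (𝓡 m) X' Y' (f x) := by
  set φ := extChartAt (𝓡 m) (f x) with hφ
  have hfx : f x ∈ φ.source := mem_extChartAt_source _
  have hφs : ContMDiffAt (𝓡 m) 𝓘(ℝ, EuclideanSpace ℝ (Fin m)) ∞ φ (f x) := contMDiffAt_extChartAt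
  have hinv := isInvertible_mfderiv_extChartAt (I := 𝓡 m) hfx
  have hinj : Function.Injective (mvfderiv (𝓡 m) φ (f x)) := hinv.injective
  have hφf : ContMDiffAt (𝓡 d) 𝓘(ℝ, EuclideanSpace ℝ (Fin m)) ∞ (fun y => φ (f y)) x :=
    hφs.comp x hf
  have hfd : ∀ᶠ y in 𝓝 x, MDifferentiableAt (𝓡 d) (𝓡 m) f y :=
    (contMDiffAt_iff_contMDiffAt_nhds (by simp)).1
      (hf.of_le (m := 1) (WithTop.coe_le_coe.2 le_top)) |>.mono
      fun u hu => hu.mdifferentiableAt (by simp)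
  have hφd : ∀ᶠ y in 𝓝 x, MDifferentiableAt (𝓡 m) 𝓘(ℝ, EuclideanSpace ℝ (Fin m)) φ (f y) := by
    filter_upwards [hf.continuousAt.eventually (extChartAt_source_mem_nhds (I := 𝓡 m) (f x))]
      with y hy
    exact mdifferentiableAt_extChartAt ((extChartAt_source (𝓡 m) (f x)) ▸ hy)
  have key : ∀ (V W : ∀ y : L, TangentSpace (𝓡 d) y) (V' W' : ∀ y : M, TangentSpace (𝓡 m) y),
      MDifferentiableAt (𝓡 m) (𝓡 m).tangent
        (fun y => (⟨y, V' y⟩ : TangentBundle (𝓡 m) M)) (f x) →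
      (∀ᶠ y in 𝓝 x, V' (f y) = mfderiv (𝓡 d) (𝓡 m) f y (V y)) →
      (∀ᶠ y in 𝓝 x, W' (f y) = mfderiv (𝓡 d) (𝓡 m) f y (W y)) →
      mvfderiv (𝓡 d) (fun y => mvfderiv (𝓡 d) (fun z => φ (f z)) y (V y)) x (W x) =
        mvfderiv (𝓡 m) (fun y => mvfderiv (𝓡 m) φ y (V' y)) (f x) (W' (f x)) := by
    intro V W V' W' hV' eV eW
    have e1 : ∀ᶠ y in 𝓝 x, mvfderiv (𝓡 d) (fun z => φ (f z)) y (V y) =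
        (fun z => mvfderiv (𝓡 m) φ z (V' z)) (f y) := by
      filter_upwards [hfd, hφd, eV] with y h1 h2 h3
      rw [mvfderiv_comp_apply' h2 h1, ← h3]
    rw [mvfderiv_congr e1, mvfderiv_comp_apply' (h := fun z => mvfderiv (𝓡 m) φ z (V' z)) ?_
      hfd.self_of_nhds, ← eW.self_of_nhds]
    have e2 : ∀ᶠ y in 𝓝 (f x), chartField (f x) V' (φ y) = mvfderiv (𝓡 m) φ y (V' y) := by
      filter_upwards [extChartAt_source_mem_nhds (I := 𝓡 m) (f x)] with y hy
      exact chartField_extChartAt V' hy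
    refine MDifferentiableAt.congr_of_eventuallyEq ?_ (Filter.EventuallyEq.symm e2)
    exact (differentiableAt_chartField hV').mdifferentiableAt.comp (f x)
      (hφs.mdifferentiableAt (by simp))
  -- The derivative of the chart is injective, so both brackets may be tested on the chart, where
  -- each is a commutator of directional derivatives.
  apply hinj
  rw [mvfderiv_mlieBracket hφs hX' hY', ← mvfderiv_comp_apply' hφd.self_of_nhds hfd.self_of_nhds,
    mvfderiv_mlieBracket hφf hX hY, key Y X Y' X' hY' eY eX, key X Y X' Y' hX' eX eY]

end Brackets

/-! ### Local left inverses of immersions and extension of vector fields. -/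

section Retractions

variable {d m k : ℕ}
  {L : Type*} [TopologicalSpace L] [ChartedSpace (EuclideanSpace ℝ (Fin d)) L]
  {M : Type*} [TopologicalSpace M] [ChartedSpace (EuclideanSpace ℝ (Fin m)) M]
  {N : Type*} [TopologicalSpace N] [ChartedSpace (EuclideanSpace ℝ (Fin k)) N]

/-- A smooth map which near every point of its domain has a smooth left inverse. -/
structure HasRetractions (f : L → M) : Prop where
  contMDiff : ContMDiff (𝓡 d) (𝓡 m) ∞ f
  exists_retraction : ∀ x, ∃ ρ : M → L, ContMDiffAt (𝓡 m) (𝓡 d) ∞ ρ (f x) ∧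
    ∀ᶠ y in 𝓝 x, ρ (f y) = y

lemma HasRetractions.comp {j : M → N} {ι : L → M} (hj : HasRetractions (d := m) (m := k) j)
    (hι : HasRetractions (d := d) (m := m) ι) : HasRetractions (d := d) (m := k) (j ∘ ι) where
  contMDiff := hj.contMDiff.comp hι.contMDiff
  exists_retraction x := by
    obtain ⟨ρ, hρ, eρ⟩ := hι.exists_retraction x
    obtain ⟨τ, hτ, eτ⟩ := hj.exists_retraction (ι x)
    refine ⟨ρ ∘ τ, ContMDiffAt.comp _ (by simpa [eτ.self_of_nhds] using hρ) hτ, ?_⟩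
    filter_upwards [eρ, hι.contMDiff.continuous.continuousAt.eventually eτ] with y h1 h2
    simp [h1, h2]

/-- In immersion charts `f` reads `u ↦ (u, 0)` up to a linear equivalence, so projecting to the
first factor inverts it. Smoothness is needed only at `f x`; the values far from there are
irrelevant. -/
lemma hasRetractions_of_isImmersion [IsManifold (𝓡 d) ∞ L] [IsManifold (𝓡 m) ∞ M] {f : L → M}
    (hf : Manifold.IsImmersion (𝓡 d) (𝓡 m) ∞ f) :
    HasRetractions (d := d) (m := m) f where
  contMDiff := hf.contMDiff
  exists_retraction x := by
    have h := hf.isImmersionAt x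
    set φ := h.domChart.extend (𝓡 d) with hφ
    set ψ := h.codChart.extend (𝓡 m) with hψ
    have key : ∀ y ∈ h.domChart.source, ψ (f y) = h.equiv (φ y, 0) := by
      intro y hy
      have hy' : y ∈ φ.source := by simpa [hφ] using hy
      have := h.writtenInCharts (φ.map_source hy')
      simp only [Function.comp_apply] at this
      rwa [← hφ, φ.left_inv hy'] at this
    have hx : x ∈ φ.source := by simpa [hφ] using h.mem_domChart_source
    refine ⟨fun z => φ.symm (h.equiv.symm (ψ z)).1, ?_, ?_⟩
    · have h1 : ContMDiffAt (𝓡 m) 𝓘(ℝ, EuclideanSpace ℝ (Fin m)) ∞ ψ (f x) :=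
        h.codChart.contMDiffAt_extend h.codChart_mem_maximalAtlas h.mem_codChart_source
      have h2 : ContMDiff 𝓘(ℝ, EuclideanSpace ℝ (Fin m)) 𝓘(ℝ, EuclideanSpace ℝ (Fin d)) ∞
          (fun u => (h.equiv.symm u).1) :=
        (contDiff_fst.comp h.equiv.symm.contDiff).contMDiff
      have h3 : ContMDiffAt 𝓘(ℝ, EuclideanSpace ℝ (Fin d)) (𝓡 d) ∞ φ.symm (φ x) := by
        refine (contMDiffOn_extend_symm h.domChart_mem_maximalAtlas).contMDiffAt ?_
        have : IsOpen ((𝓡 d) '' h.domChart.target) := by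
          simpa using h.domChart.open_target
        refine this.mem_nhds ⟨h.domChart x, h.domChart.map_source h.mem_domChart_source, rfl⟩
      have h4 : (h.equiv.symm (ψ (f x))).1 = φ x := by
        rw [key x h.mem_domChart_source]; simp
      refine ContMDiffAt.comp (f x) (g := φ.symm) ?_ (h2.contMDiffAt.comp (f x) h1)
      simpa only [Function.comp_apply, h4] using h3
    · filter_upwards [h.domChart.open_source.mem_nhds h.mem_domChart_source] with y hy
      have hy' : y ∈ φ.source := by simpa [hφ] using hy
      rw [key y hy]
      simp [φ.left_inv hy']

variable {f : L → M}

lemma HasRetractions.mdifferentiableAt (hf : HasRetractions (d := d) (m := m) f) (x : L) :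
    MDifferentiableAt (𝓡 d) (𝓡 m) f x :=
  hf.contMDiff.contMDiffAt.mdifferentiableAt (by simp)

lemma mfderiv_retraction {x : L} {ρ : M → L} (hf : MDifferentiableAt (𝓡 d) (𝓡 m) f x)
    (hρ : MDifferentiableAt (𝓡 m) (𝓡 d) ρ (f x)) (e : ∀ᶠ y in 𝓝 x, ρ (f y) = y)
    (v : TangentSpace (𝓡 d) x) :
    mfderiv (𝓡 m) (𝓡 d) ρ (f x) (mfderiv (𝓡 d) (𝓡 m) f x v) = v := by
  have h1 := mfderiv_comp_apply x hρ hf v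
  have h2 : mfderiv (𝓡 d) (𝓡 d) (ρ ∘ f) x = mfderiv (𝓡 d) (𝓡 d) id x :=
    Filter.EventuallyEq.mfderiv_eq e
  rw [← h1]
  exact (congrArg (fun A => A v) h2).trans (by rw [mfderiv_id])

lemma HasRetractions.mfderiv_injective (hf : HasRetractions (d := d) (m := m) f) (x : L) :
    Function.Injective (mfderiv (𝓡 d) (𝓡 m) f x) := by
  obtain ⟨ρ, hρ, e⟩ := hf.exists_retraction x
  exact Function.LeftInverse.injective (g := mfderiv (𝓡 m) (𝓡 d) ρ (f x))
    (mfderiv_retraction (hf.mdifferentiableAt x) (hρ.mdifferentiableAt (by simp)) e)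

variable [IsManifold (𝓡 d) ∞ L] [IsManifold (𝓡 m) ∞ M]

/-- A vector field on the source extends along `f` to a vector field on the target. -/
lemma HasRetractions.exists_extension (hf : HasRetractions (d := d) (m := m) f) {x : L}
    {Y : ∀ y : L, TangentSpace (𝓡 d) y}
    (hY : MDifferentiableAt (𝓡 d) (𝓡 d).tangent
      (fun y => (⟨y, Y y⟩ : TangentBundle (𝓡 d) L)) x) :
    ∃ Z : ∀ y : M, TangentSpace (𝓡 m) y,
      MDifferentiableAt (𝓡 m) (𝓡 m).tangent
        (fun y => (⟨y, Z y⟩ : TangentBundle (𝓡 m) M)) (f x) ∧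
      ∀ᶠ y in 𝓝 x, Z (f y) = mfderiv (𝓡 d) (𝓡 m) f y (Y y) := by
  obtain ⟨ρ, hρ, e⟩ := hf.exists_retraction x
  set t := trivializationAt (EuclideanSpace ℝ (Fin m)) (TangentSpace (𝓡 m) : M → Type _) (f x)
    with ht
  have hbase : t.baseSet ∈ 𝓝 (f x) := t.open_baseSet.mem_nhds (mem_baseSet_trivializationAt _ _ _)
  -- The pushed-forward field, read in a trivialization, takes values in a fixed vector space. Its
  -- coordinates can then be carried off the image of `f` by composing with `ρ`.
  set c : L → EuclideanSpace ℝ (Fin m) := fun y =>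
    (t (⟨f y, mfderiv (𝓡 d) (𝓡 m) f y (Y y)⟩ : TangentBundle (𝓡 m) M)).2 with hc
  have hcd : MDifferentiableAt (𝓡 d) 𝓘(ℝ, EuclideanSpace ℝ (Fin m)) c x := by
    have h1 : MDifferentiableAt (𝓡 d) (𝓡 m).tangent
        (fun y => (⟨f y, mfderiv (𝓡 d) (𝓡 m) f y (Y y)⟩ : TangentBundle (𝓡 m) M)) x := by
      have h2 : ContMDiff (𝓡 d).tangent (𝓡 m).tangent 1 (tangentMap (𝓡 d) (𝓡 m) f) :=
        hf.contMDiff.contMDiff_tangentMap (WithTop.coe_le_coe.2 le_top)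
      exact (h2.mdifferentiable (by simp) _).comp x hY
    exact ((mdifferentiableAt_totalSpace _ _).1 h1).2
  refine ⟨fun z => t.symm z (c (ρ z)), ?_, ?_⟩
  · rw [mdifferentiableAt_section]
    have h1 : MDifferentiableAt (𝓡 m) 𝓘(ℝ, EuclideanSpace ℝ (Fin m)) (fun z => c (ρ z)) (f x) := by
      refine MDifferentiableAt.comp (f x) (g := c) ?_ (hρ.mdifferentiableAt (by simp))
      rwa [e.self_of_nhds]
    refine h1.congr_of_eventuallyEq ?_
    filter_upwards [hbase] with z hz
    rw [← ht, t.apply_mk_symm hz]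
  · filter_upwards [e, hf.contMDiff.continuous.continuousAt.eventually hbase] with y h1 h2
    rw [h1]
    exact t.symm_apply_apply_mk h2 _

/-- The derivative of a smooth map applied to a smooth vector field along a map is smooth. -/
lemma contMDiffAt_mfderiv_apply {K : Type*} [TopologicalSpace K] {c : ℕ}
    [ChartedSpace (EuclideanSpace ℝ (Fin c)) K] {x : K} {b : K → L}
    {f : L → M} (hf : ContMDiffAt (𝓡 d) (𝓡 m) ∞ f (b x))
    {v : ∀ y : K, TangentSpace (𝓡 d) (b y)}
    (hv : ContMDiffAt (𝓡 c) (𝓡 d).tangent ∞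
      (fun y => (⟨b y, v y⟩ : TangentBundle (𝓡 d) L)) x) :
    ContMDiffAt (𝓡 c) (𝓡 m).tangent ∞
      (fun y => (⟨f (b y), mfderiv (𝓡 d) (𝓡 m) f (b y) (v y)⟩ : TangentBundle (𝓡 m) M)) x := by
  have hb : ContMDiffAt (𝓡 c) (𝓡 d) ∞ b x := (contMDiffAt_totalSpace.1 hv).1
  exact ContMDiffAt.clm_apply_of_inCoordinates (b₁ := b) (b₂ := fun y => f (b y))
    ((hf.mfderiv_const (m := ∞) (by simp)).comp x hb) hv (hf.comp x hb)

end Retractions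

/-! ### A smoothness criterion for tensor fields. -/

section Hom

variable {d : ℕ}
  {L : Type*} [TopologicalSpace L] [ChartedSpace (EuclideanSpace ℝ (Fin d)) L]
  [IsManifold (𝓡 d) ∞ L]
  {F : Type*} [NormedAddCommGroup F] [NormedSpace ℝ F] {V : L → Type*}
  [TopologicalSpace (TotalSpace F V)] [∀ x, AddCommGroup (V x)] [∀ x, Module ℝ (V x)]
  [∀ x, TopologicalSpace (V x)] [∀ x, IsTopologicalAddGroup (V x)]
  [∀ x, ContinuousSMul ℝ (V x)] [FiberBundle F V] [VectorBundle ℝ F V]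

/-- A family of linear maps on the tangent spaces is smooth if it maps smooth vector fields to
smooth sections. -/
lemma contMDiffAt_hom_of_apply {x : L} (s : ∀ y : L, TangentSpace (𝓡 d) y →L[ℝ] V y)
    (hs : ∀ X : ∀ y : L, TangentSpace (𝓡 d) y,
      ContMDiffAt (𝓡 d) (𝓡 d).tangent ∞ (fun y => (⟨y, X y⟩ : TangentBundle (𝓡 d) L)) x →
      ContMDiffAt (𝓡 d) ((𝓡 d).prod 𝓘(ℝ, F)) ∞ (fun y => TotalSpace.mk' F y (s y (X y))) x) :
    ContMDiffAt (𝓡 d) ((𝓡 d).prod 𝓘(ℝ, EuclideanSpace ℝ (Fin d) →L[ℝ] F)) ∞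
      (fun y => TotalSpace.mk' (EuclideanSpace ℝ (Fin d) →L[ℝ] F)
        (E := fun y => TangentSpace (𝓡 d) y →L[ℝ] V y) y (s y)) x := by
  rw [contMDiffAt_hom_bundle]
  refine ⟨contMDiffAt_id, ?_⟩
  set t := trivializationAt (EuclideanSpace ℝ (Fin d)) (TangentSpace (𝓡 d) : L → Type _) x with ht
  set t' := trivializationAt F V x with ht'
  have hb : ∀ᶠ y in 𝓝 x, y ∈ t.baseSet :=
    t.open_baseSet.mem_nhds (mem_baseSet_trivializationAt _ _ _)
  have hb' : ∀ᶠ y in 𝓝 x, y ∈ t'.baseSet :=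
    t'.open_baseSet.mem_nhds (mem_baseSet_trivializationAt _ _ _)
  let b := EuclideanSpace.basisFun (Fin d) ℝ
  set A : L → EuclideanSpace ℝ (Fin d) →L[ℝ] F := fun y =>
    ContinuousLinearMap.inCoordinates (EuclideanSpace ℝ (Fin d)) (TangentSpace (𝓡 d)) F V
      x y x y (s y) with hA
  -- The fields with constant coordinates in the trivialization are smooth test fields, and their
  -- images are the columns of `A`.
  have hAi : ∀ i, ContMDiffAt (𝓡 d) 𝓘(ℝ, F) ∞ (fun y => A y (b i)) x := by
    intro i
    have h1 : ContMDiffAt (𝓡 d) (𝓡 d).tangent ∞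
        (fun y => (⟨y, t.symm y (b i)⟩ : TangentBundle (𝓡 d) L)) x := by
      refine contMDiffAt_section _ |>.2 ?_
      refine (contMDiffAt_const (c := b i)).congr_of_eventuallyEq ?_
      filter_upwards [hb] with y hy
      exact congrArg Prod.snd (t.apply_mk_symm hy _)
    have h2 := (contMDiffAt_section _ |>.1 (hs _ h1))
    refine h2.congr_of_eventuallyEq ?_
    filter_upwards [hb, hb'] with y hy hy'
    simp only [hA]
    rw [ContinuousLinearMap.inCoordinates_eq hy hy']
    simp [← ht, ← ht']
  have hsum : A = fun y => ∑ i, (ContinuousLinearMap.smulRightL ℝ (EuclideanSpace ℝ (Fin d)) F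
      (EuclideanSpace.proj i : EuclideanSpace ℝ (Fin d) →L[ℝ] ℝ)) (A y (b i)) := by
    ext1 y
    ext1 v
    conv_lhs => rw [← b.sum_repr v]
    simp [b]
  change ContMDiffAt _ _ _ A x
  rw [hsum]
  refine ContMDiffAt.sum fun i _ => ?_
  exact (ContinuousLinearMap.contDiff _).contMDiff.contMDiffAt.comp x (hAi i)

end Hom

/-! ### Induced connections and the Gauss formula. -/

section Connections

variable {d m : ℕ}
  {L : Type*} [TopologicalSpace L] [ChartedSpace (EuclideanSpace ℝ (Fin d)) L]
  [IsManifold (𝓡 d) ∞ L]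
  {M : Type*} [TopologicalSpace M] [ChartedSpace (EuclideanSpace ℝ (Fin m)) M]
  [IsManifold (𝓡 m) ∞ M] {f : L → M}

/-- A covariant derivative in directions tangent to `f` only depends on the section along `f`. -/
lemma cov_congr_along {x : L} (hf : MDifferentiableAt (𝓡 d) (𝓡 m) f x)
    (cov : CovariantDerivative (𝓡 m) (EuclideanSpace ℝ (Fin m))
      (TangentSpace (𝓡 m) : M → Type _)) {Z Z' : ∀ y : M, TangentSpace (𝓡 m) y}
    (hZ : MDifferentiableAt (𝓡 m) (𝓡 m).tangent
      (fun y => (⟨y, Z y⟩ : TangentBundle (𝓡 m) M)) (f x))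
    (hZ' : MDifferentiableAt (𝓡 m) (𝓡 m).tangent
      (fun y => (⟨y, Z' y⟩ : TangentBundle (𝓡 m) M)) (f x))
    (e : ∀ᶠ y in 𝓝 x, Z (f y) = Z' (f y)) (v : TangentSpace (𝓡 d) x) :
    cov Z (f x) (mfderiv (𝓡 d) (𝓡 m) f x v) = cov Z' (f x) (mfderiv (𝓡 d) (𝓡 m) f x v) := by
  have hcov := cov.isCovariantDerivativeOnUniv
  set t := trivializationAt (EuclideanSpace ℝ (Fin m)) (TangentSpace (𝓡 m) : M → Type _) (f x)
    with ht
  have hfx : f x ∈ t.baseSet := mem_baseSet_trivializationAt _ _ _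
  let b := (EuclideanSpace.basisFun (Fin m) ℝ).toBasis
  let W : Fin m → ∀ y : M, TangentSpace (𝓡 m) y := t.localFrame b
  have hW : ∀ i, MDifferentiableAt (𝓡 m) (𝓡 m).tangent
      (fun y => (⟨y, W i y⟩ : TangentBundle (𝓡 m) M)) (f x) := fun i =>
    (contMDiffAt_localFrame_of_mem (n := 1) (I := 𝓡 m) t b i hfx).mdifferentiableAt (by simp)
  let c : (∀ y : M, TangentSpace (𝓡 m) y) → Fin m → M → ℝ := fun Y i y =>
    t.localFrameCoeff (𝓡 m) b i y (Y y)
  have hc : ∀ Y, MDifferentiableAt (𝓡 m) (𝓡 m).tangent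
      (fun y => (⟨y, Y y⟩ : TangentBundle (𝓡 m) M)) (f x) → ∀ i,
      MDifferentiableAt (𝓡 m) 𝓘(ℝ, ℝ) (c Y i) (f x) := fun Y hY i =>
    mdifferentiableAt_localFrameCoeff b hfx hY i
  have hsum : ∀ (s : Finset (Fin m)) (Y : ∀ y : M, TangentSpace (𝓡 m) y),
      MDifferentiableAt (𝓡 m) (𝓡 m).tangent
        (fun y => (⟨y, Y y⟩ : TangentBundle (𝓡 m) M)) (f x) →
      MDifferentiableAt (𝓡 m) (𝓡 m).tangent
        (fun y => (⟨y, (∑ i ∈ s, c Y i • W i) y⟩ : TangentBundle (𝓡 m) M)) (f x) ∧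
      cov (∑ i ∈ s, c Y i • W i) (f x) = ∑ i ∈ s, (c Y i (f x) • cov (W i) (f x) +
        (mvfderiv (𝓡 m) (c Y i) (f x)).smulRight (W i (f x))) := by
    intro s Y hY
    induction s using Finset.induction_on with
    | empty =>
      simp only [Finset.sum_empty]
      exact ⟨(mdifferentiableAt_zeroSection ..), hcov.zero⟩
    | insert i s hi ih =>
      have h1 := MDifferentiableAt.smul_section (hc Y hY i) (hW i)
      simp only [Finset.sum_insert hi]
      refine ⟨mdifferentiableAt_add_section h1 ih.1, ?_⟩
      rw [hcov.add h1 ih.1, hcov.leibniz (hW i) (hc Y hY i), ih.2]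
  -- In a local frame, `cov Y` involves only the coefficients of `Y` and their differentials. In a
  -- direction tangent to `f` the latter are differentials of the coefficients composed with `f`, so
  -- only `Y` along `f` matters.
  have hloc : ∀ Y, MDifferentiableAt (𝓡 m) (𝓡 m).tangent
        (fun y => (⟨y, Y y⟩ : TangentBundle (𝓡 m) M)) (f x) →
      cov Y (f x) = ∑ i, (c Y i (f x) • cov (W i) (f x) +
        (mvfderiv (𝓡 m) (c Y i) (f x)).smulRight (W i (f x))) := by
    intro Y hY
    rw [← (hsum Finset.univ Y hY).2]
    refine hcov.congr_of_eventuallyEq hY (hsum Finset.univ Y hY).1 Filter.univ_mem ?_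
    filter_upwards [t.eventually_eq_localFrame_sum_coeff_smul (I := 𝓡 m) b hfx (s := Y)] with y hy
    rw [hy]
    simp [c, W]
  rw [hloc Z hZ, hloc Z' hZ']
  have hcoef : ∀ i, ∀ᶠ y in 𝓝 x, c Z i (f y) = c Z' i (f y) := fun i => by
    filter_upwards [e] with y hy
    simp only [c, hy]
  simp only [sum_apply, add_apply,
    smul_apply, ContinuousLinearMap.smulRight_apply]
  refine Finset.sum_congr rfl fun i _ => ?_
  rw [(hcoef i).self_of_nhds, ← mvfderiv_comp_apply' (hc Z hZ i) hf,
    ← mvfderiv_comp_apply' (hc Z' hZ' i) hf, mvfderiv_congr (hcoef i)]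

/-- A field of complements of the tangent spaces induces a connection. -/
lemma HasRetractions.exists_isInducedConnection (hf : HasRetractions (d := d) (m := m) f)
    (K : ∀ x : L, Submodule ℝ (TangentSpace (𝓡 m) (f x)))
    (hK : ∀ x, IsCompl (mfderiv (𝓡 d) (𝓡 m) f x).range (K x))
    (covM : CovariantDerivative (𝓡 m) (EuclideanSpace ℝ (Fin m))
      (TangentSpace (𝓡 m) : M → Type _)) :
    ∃ covL : CovariantDerivative (𝓡 d) (EuclideanSpace ℝ (Fin d))
      (TangentSpace (𝓡 d) : L → Type _), IsInducedConnection f K covM covL := by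
  classical
  -- `ℓ` is the projection along `K x` followed by the inverse of the derivative of `f` on its
  -- range.
  have hproj : ∀ x, ∃ ℓ : TangentSpace (𝓡 m) (f x) →L[ℝ] TangentSpace (𝓡 d) x,
      (∀ v, ℓ (mfderiv (𝓡 d) (𝓡 m) f x v) = v) ∧
      ∀ w, w - mfderiv (𝓡 d) (𝓡 m) f x (ℓ w) ∈ K x := by
    intro x
    have hfd : FiniteDimensional ℝ (TangentSpace (𝓡 m) (f x)) :=
      inferInstanceAs (FiniteDimensional ℝ (EuclideanSpace ℝ (Fin m)))
    have hT2 : T2Space (TangentSpace (𝓡 d) x) :=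
      inferInstanceAs (T2Space (EuclideanSpace ℝ (Fin d)))
    have hT2' : T2Space (TangentSpace (𝓡 m) (f x)) :=
      inferInstanceAs (T2Space (EuclideanSpace ℝ (Fin m)))
    let A : TangentSpace (𝓡 d) x →ₗ[ℝ] TangentSpace (𝓡 m) (f x) :=
      (mfderiv (𝓡 d) (𝓡 m) f x).toLinearMap
    let e := LinearEquiv.ofInjective A (hf.mfderiv_injective x)
    let P := Submodule.projectionOnto _ _ (hK x)
    refine ⟨LinearMap.toContinuousLinearMap (e.symm.toLinearMap ∘ₗ P), ?_, ?_⟩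
    · intro v
      have h1 : P (A v) = e v := Submodule.projectionOnto_apply_left (hK x) (e v)
      change e.symm (P (A v)) = v
      rw [h1, e.symm_apply_apply]
    · intro w
      have h1 : A (e.symm (P w)) = (P w : TangentSpace (𝓡 m) (f x)) :=
        congrArg Subtype.val (e.apply_symm_apply (P w))
      change w - A (e.symm (P w)) ∈ K x
      rw [h1, ← Submodule.ker_projectionOnto (hK x), LinearMap.mem_ker, map_sub,
        Submodule.projectionOnto_apply_left, sub_self]
  choose ℓ hℓ hℓK using hproj
  -- An extension is chosen separately at each point. The value `0` for a field not differentiable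
  -- at `x` is harmless: the connection axioms and the Gauss formula concern only fields
  -- differentiable there.
  have hext : ∀ (x : L) (Y : ∀ y : L, TangentSpace (𝓡 d) y),
      ∃ Z : ∀ y : M, TangentSpace (𝓡 m) y,
      MDifferentiableAt (𝓡 d) (𝓡 d).tangent
        (fun y => (⟨y, Y y⟩ : TangentBundle (𝓡 d) L)) x →
      MDifferentiableAt (𝓡 m) (𝓡 m).tangent
        (fun y => (⟨y, Z y⟩ : TangentBundle (𝓡 m) M)) (f x) ∧
      ∀ᶠ y in 𝓝 x, Z (f y) = mfderiv (𝓡 d) (𝓡 m) f y (Y y) := by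
    intro x Y
    by_cases hY : MDifferentiableAt (𝓡 d) (𝓡 d).tangent
        (fun y => (⟨y, Y y⟩ : TangentBundle (𝓡 d) L)) x
    · obtain ⟨Z, hZ⟩ := hf.exists_extension hY
      exact ⟨Z, fun _ => hZ⟩
    · exact ⟨0, fun h => absurd h hY⟩
  choose ext hext using hext
  let D : (∀ y : L, TangentSpace (𝓡 d) y) → ∀ x : L, TangentSpace (𝓡 d) x →L[ℝ]
      TangentSpace (𝓡 d) x := fun Y x =>
    (ℓ x).comp ((covM (ext x Y) (f x)).comp (mfderiv (𝓡 d) (𝓡 m) f x))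
  have hD : ∀ (x : L) (Y : ∀ y : L, TangentSpace (𝓡 d) y) (Z : ∀ y : M, TangentSpace (𝓡 m) y),
      MDifferentiableAt (𝓡 d) (𝓡 d).tangent (fun y => (⟨y, Y y⟩ : TangentBundle (𝓡 d) L)) x →
      MDifferentiableAt (𝓡 m) (𝓡 m).tangent
        (fun y => (⟨y, Z y⟩ : TangentBundle (𝓡 m) M)) (f x) →
      (∀ᶠ y in 𝓝 x, Z (f y) = mfderiv (𝓡 d) (𝓡 m) f y (Y y)) → ∀ v,
      D Y x v = ℓ x (covM Z (f x) (mfderiv (𝓡 d) (𝓡 m) f x v)) := by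
    intro x Y Z hY hZ e v
    obtain ⟨h1, h2⟩ := hext x Y hY
    refine congrArg (ℓ x) (cov_congr_along (hf.mdifferentiableAt x) covM h1 hZ ?_ v)
    filter_upwards [e, h2] with y h3 h4
    rw [h3, h4]
  refine ⟨⟨D, ?_, ?_⟩, ?_⟩
  · intro Y Y' x hY hY' _
    obtain ⟨h1, h2⟩ := hext x Y hY
    obtain ⟨h1', h2'⟩ := hext x Y' hY'
    ext1 v
    rw [hD x (Y + Y') (ext x Y + ext x Y') (mdifferentiableAt_add_section hY hY')
      (mdifferentiableAt_add_section h1 h1') (by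
        filter_upwards [h2, h2'] with y h3 h4
        simp [h3, h4]), covM.isCovariantDerivativeOnUniv.add h1 h1']
    simp [D]
  · intro Y g x hY hg _
    obtain ⟨h1, h2⟩ := hext x Y hY
    -- The coefficient `g` lives on `L`; composing it with `ρ` gives a function on `M` that agrees
    -- with it along `f` near `x`.
    obtain ⟨ρ, hρ, eρ⟩ := hf.exists_retraction x
    have hgρ : MDifferentiableAt (𝓡 m) 𝓘(ℝ, ℝ) (fun z => g (ρ z)) (f x) := by
      refine MDifferentiableAt.comp (f x) (g := g) ?_ (hρ.mdifferentiableAt (by simp))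
      rwa [eρ.self_of_nhds]
    ext1 v
    rw [hD x (g • Y) ((fun z => g (ρ z)) • ext x Y) (MDifferentiableAt.smul_section hg hY)
      (MDifferentiableAt.smul_section hgρ h1) (by
        filter_upwards [h2, eρ] with y h3 h4
        simp [h3, h4]), covM.isCovariantDerivativeOnUniv.leibniz h1 hgρ]
    have h5 : mvfderiv (𝓡 m) (fun z => g (ρ z)) (f x) (mfderiv (𝓡 d) (𝓡 m) f x v) =
        mvfderiv (𝓡 d) g x v := by
      rw [← mvfderiv_comp_apply' hgρ (hf.mdifferentiableAt x)]
      rw [mvfderiv_congr (h' := g) (eρ.mono fun y hy => by rw [hy])]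
    simp [D, h5, eρ.self_of_nhds, h2.self_of_nhds, hℓ]
  · intro x Y Z hY hZ e v
    change _ - mfderiv (𝓡 d) (𝓡 m) f x (D Y x v) ∈ K x
    rw [hD x Y Z hY hZ e v]
    exact hℓK x _

/-- The Levi-Civita connection of a non-degenerate submanifold is the tangential part of the
ambient Levi-Civita connection. -/
lemma HasRetractions.isLeviCivita (hf : HasRetractions (d := d) (m := m) f)
    (g : SemiRiemannianMetric m M) (gL : SemiRiemannianMetric d L)
    (hg : ∀ x v w, gL.inner x v w =
      g.inner (f x) (mfderiv (𝓡 d) (𝓡 m) f x v) (mfderiv (𝓡 d) (𝓡 m) f x w))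
    {covM : CovariantDerivative (𝓡 m) (EuclideanSpace ℝ (Fin m))
      (TangentSpace (𝓡 m) : M → Type _)} (hcov : IsLeviCivita g covM)
    (covL : CovariantDerivative (𝓡 d) (EuclideanSpace ℝ (Fin d))
      (TangentSpace (𝓡 d) : L → Type _))
    (h : ∀ (x : L) (Y : ∀ y : L, TangentSpace (𝓡 d) y),
      MDifferentiableAt (𝓡 d) (𝓡 d).tangent (fun y => (⟨y, Y y⟩ : TangentBundle (𝓡 d) L)) x →
      ∃ Z : ∀ y : M, TangentSpace (𝓡 m) y,
        MDifferentiableAt (𝓡 m) (𝓡 m).tangent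
          (fun y => (⟨y, Z y⟩ : TangentBundle (𝓡 m) M)) (f x) ∧
        (∀ᶠ y in 𝓝 x, Z (f y) = mfderiv (𝓡 d) (𝓡 m) f y (Y y)) ∧
        ∀ v w, g.inner (f x) (covM Z (f x) (mfderiv (𝓡 d) (𝓡 m) f x v))
            (mfderiv (𝓡 d) (𝓡 m) f x w) = gL.inner x (covL Y x v) w) :
    IsLeviCivita gL covL := by
  constructor
  · rw [CovariantDerivative.torsion_eq_zero_iff]
    intro X Y x hX hY
    obtain ⟨X', hX', eX, cX⟩ := h x X hX
    obtain ⟨Y', hY', eY, cY⟩ := h x Y hY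
    rw [← sub_eq_zero]
    -- After pairing with tangent vectors, `covL` may be replaced by `covM` of the extensions, and
    -- the bracket by the ambient one.
    refine gL.nondegenerate x _ fun w => ?_
    have h1 := (covM.torsion_eq_zero_iff.1 hcov.1) hX' hY'
    rw [← mfderiv_mlieBracket hf.contMDiff.contMDiffAt hX hY hX' hY' eX eY, eX.self_of_nhds,
      eY.self_of_nhds] at h1
    simp only [map_sub, sub_apply]
    rw [← cX, ← cY, hg x _ w, ← h1]
    simp
  · intro x Y Z hY hZ v
    obtain ⟨Y', hY', eY, cY⟩ := h x Y hY
    obtain ⟨Z', hZ', eZ, cZ⟩ := h x Z hZ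
    have e : ∀ᶠ y in 𝓝 x, gL.inner y (Y y) (Z y) = g.inner (f y) (Y' (f y)) (Z' (f y)) := by
      filter_upwards [eY, eZ] with y h1 h2
      rw [hg, h1, h2]
    have hd : MDifferentiableAt (𝓡 m) 𝓘(ℝ, ℝ) (fun y => g.inner y (Y' y) (Z' y)) (f x) := by
      have h1 := MDifferentiableAt.clm_bundle_apply₂
        (F₁ := EuclideanSpace ℝ (Fin m)) (F₂ := EuclideanSpace ℝ (Fin m)) (F₃ := ℝ)
        (E₁ := (TangentSpace (𝓡 m) : M → Type _)) (E₂ := (TangentSpace (𝓡 m) : M → Type _))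
        (E₃ := Bundle.Trivial M ℝ) (b := id)
        ((g.contMDiff (f x)).mdifferentiableAt (by simp)) hY' hZ'
      exact ((mdifferentiableAt_totalSpace _ _).1 h1).2
    rw [mvfderiv_congr e, mvfderiv_comp_apply' (h := fun y => g.inner y (Y' y) (Z' y)) hd
      (hf.mdifferentiableAt x), hcov.2 (f x) Y' Z' hY' hZ',
      eZ.self_of_nhds, eY.self_of_nhds, cY, g.symm, cZ, gL.symm x (covL Z x v)]

end Connections

/-! ### Hyperbolic pairs, index, and frames of lightlike hyperplanes. -/

section LinearAlgebra

open Module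

variable {V : Type*} [AddCommGroup V] [Module ℝ V]

/-- The form `b` is negative definite on the subspace `W`. -/
def IsNegOn (b : LinearMap.BilinForm ℝ V) (W : Submodule ℝ V) : Prop :=
  ∀ w ∈ W, w ≠ 0 → b w w < 0

/-- `e`, `f` is a hyperbolic pair for `b`. -/
structure IsHyperbolicPair (b : LinearMap.BilinForm ℝ V) (e f : V) : Prop where
  left : b e e = 0
  right : b f f = 0
  mul : b e f = 1

/-- The vectors of `A` orthogonal to `e` and `f`. -/
def perp₂ (b : LinearMap.BilinForm ℝ V) (A : Submodule ℝ V) (e f : V) : Submodule ℝ V :=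
  A ⊓ LinearMap.ker (b.flip e) ⊓ LinearMap.ker (b.flip f)

lemma mem_perp₂ {b : LinearMap.BilinForm ℝ V} {A : Submodule ℝ V} {e f v : V} :
    v ∈ perp₂ b A e f ↔ v ∈ A ∧ b v e = 0 ∧ b v f = 0 := by
  simp [perp₂, and_assoc]

lemma finrank_map_of_injOn {V' : Type*} [AddCommGroup V'] [Module ℝ V'] {q : V →ₗ[ℝ] V'}
    {W : Submodule ℝ V} (h : ∀ w ∈ W, q w = 0 → w = 0) :
    finrank ℝ (W.map q) = finrank ℝ W := by
  rw [← LinearMap.range_domRestrict]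
  refine LinearMap.finrank_range_of_inj ?_
  rw [← LinearMap.ker_eq_bot, Submodule.eq_bot_iff]
  exact fun w hw => Subtype.ext (h w w.2 hw)

variable [FiniteDimensional ℝ V] {b : LinearMap.BilinForm ℝ V}

/-- The vector `e - f` has square `-2` and is orthogonal to `W`, so it can be added to `W`. -/
lemma IsNegOn.exists_of_perp (hb : ∀ v w, b v w = b w v)
    {A : Submodule ℝ V} {e f : V} (h : IsHyperbolicPair b e f)
    (he : e ∈ A) (hf : f ∈ A) {W : Submodule ℝ V} (hWA : W ≤ perp₂ b A e f) (hW : IsNegOn b W) :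
    ∃ W' ≤ A, IsNegOn b W' ∧ finrank ℝ W' = finrank ℝ W + 1 := by
  have hn : b (e - f) (e - f) = -2 := by
    simp [h.left, h.right, h.mul, hb f e]; norm_num
  have hn0 : e - f ≠ 0 := fun h0 => by simp [h0] at hn
  have hWn : ∀ w ∈ W, b w (e - f) = 0 := fun w hw => by
    have := mem_perp₂.1 (hWA hw)
    simp [this.2.1, this.2.2]
  have hdisj : W ⊓ ℝ ∙ (e - f) = ⊥ := by
    rw [Submodule.eq_bot_iff]
    rintro x ⟨hx, hx'⟩
    obtain ⟨c, rfl⟩ := Submodule.mem_span_singleton.1 hx'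
    have := hWn _ hx
    rw [map_smul, LinearMap.smul_apply, hn] at this
    have hc : c = 0 := by simpa using this
    simp [hc]
  refine ⟨W ⊔ ℝ ∙ (e - f), sup_le (fun w hw => (mem_perp₂.1 (hWA hw)).1) ?_, ?_, ?_⟩
  · rw [Submodule.span_singleton_le_iff_mem]
    exact A.sub_mem he hf
  · intro x hx hx0
    obtain ⟨w, hw, y, hy, rfl⟩ := Submodule.mem_sup.1 hx
    obtain ⟨c, rfl⟩ := Submodule.mem_span_singleton.1 hy
    have h1 := hWn w hw
    have e1 : b (w + c • (e - f)) (w + c • (e - f)) = b w w - 2 * c ^ 2 := by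
      simp only [map_add, map_smul, LinearMap.add_apply, LinearMap.smul_apply, hn, h1,
        hb (e - f) w, smul_eq_mul]
      ring
    rw [e1]
    by_cases hw0 : w = 0
    · subst hw0
      have hc : c ≠ 0 := by rintro rfl; simp at hx0
      simp
      positivity
    · nlinarith [hW w hw hw0, sq_nonneg c]
  · have := Submodule.finrank_sup_add_finrank_inf_eq W (ℝ ∙ (e - f))
    rw [hdisj, finrank_bot, finrank_span_singleton hn0] at this
    simpa using this

/-- Cutting `W` with the complement of `e - f` costs at most one dimension. There `b v e = b v f`,
so projecting orthogonally off the plane changes `b v v` by `-2 * b v e ^ 2`. The form stays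
negative, and in particular the projection is injective there. -/
lemma IsNegOn.exists_perp (hb : ∀ v w, b v w = b w v)
    {A : Submodule ℝ V} {e f : V} (h : IsHyperbolicPair b e f)
    (he : e ∈ A) (hf : f ∈ A) {W : Submodule ℝ V} (hWA : W ≤ A) (hW : IsNegOn b W) :
    ∃ W' ≤ perp₂ b A e f, IsNegOn b W' ∧ finrank ℝ W ≤ finrank ℝ W' + 1 := by
  let q : V →ₗ[ℝ] V := LinearMap.id - (b.flip f).smulRight e - (b.flip e).smulRight f
  have hq : ∀ v, q v = v - b v f • e - b v e • f := fun v => rfl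
  let W₁ : Submodule ℝ V := W ⊓ LinearMap.ker (b.flip (e - f))
  have hW₁ : ∀ v ∈ W₁, v ≠ 0 → b (q v) (q v) < 0 := by
    rintro v ⟨hv, hv'⟩ hv0
    have h1 : b v f = b v e := by
      have : b v (e - f) = 0 := hv'
      rw [map_sub, sub_eq_zero] at this
      exact this.symm
    have e1 : b (q v) (q v) = b v v - 2 * b v e ^ 2 := by
      simp only [hq, h1, map_sub, map_smul, LinearMap.sub_apply, LinearMap.smul_apply, hb e v,
        hb f v, h.left, h.right, h.mul, hb f e, smul_eq_mul]
      ring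
    nlinarith [hW v hv hv0, sq_nonneg (b v e)]
  refine ⟨W₁.map q, ?_, ?_, ?_⟩
  · rintro _ ⟨v, ⟨hv, -⟩, rfl⟩
    rw [mem_perp₂, hq]
    refine ⟨A.sub_mem (A.sub_mem (hWA hv) (A.smul_mem _ he)) (A.smul_mem _ hf), ?_, ?_⟩ <;>
    simp [h.left, h.right, h.mul, hb f e]
  · rintro _ ⟨v, hv, rfl⟩ h0
    exact hW₁ v hv fun hv0 => h0 (by simp [hv0])
  · have h1 : finrank ℝ (W₁.map q) = finrank ℝ W₁ := by
      refine finrank_map_of_injOn fun v hv h0 => ?_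
      by_contra hv0
      simpa [h0] using hW₁ v hv hv0
    have h2 := Submodule.finrank_sup_add_finrank_inf_eq W (LinearMap.ker (b.flip (e - f)))
    have h3 := LinearMap.finrank_range_add_finrank_ker (b.flip (e - f))
    have h4 : finrank ℝ (LinearMap.range (b.flip (e - f))) ≤ 1 := by
      simpa using Submodule.finrank_le (LinearMap.range (b.flip (e - f)))
    have h5 := Submodule.finrank_le (W ⊔ LinearMap.ker (b.flip (e - f)))
    change _ + finrank ℝ W₁ = _ at h2
    omega

/-- The orthogonal complement of two orthogonal hyperbolic pairs has index two less. -/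
lemma index_perp₂_perp₂ (hb : ∀ v w, b v w = b w v)
    {e f e' f' : V} (h : IsHyperbolicPair b e f)
    (h' : IsHyperbolicPair b e' f') (he : e' ∈ perp₂ b ⊤ e f) (hf : f' ∈ perp₂ b ⊤ e f) {ν : ℕ}
    (hν : IsIndexOf (fun v w => b v w) ν) :
    (∃ W ≤ perp₂ b (perp₂ b ⊤ e f) e' f', IsNegOn b W ∧ finrank ℝ W + 2 = ν) ∧
      ∀ W ≤ perp₂ b (perp₂ b ⊤ e f) e' f', IsNegOn b W → finrank ℝ W + 2 ≤ ν := by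
  -- Adding one negative direction from each plane gives the upper bound; removing one for each
  -- plane from a maximal negative subspace shows that it is attained.
  have hup : ∀ W ≤ perp₂ b (perp₂ b ⊤ e f) e' f', IsNegOn b W → finrank ℝ W + 2 ≤ ν := by
    intro W hW hWn
    obtain ⟨W₁, h1, h1n, e1⟩ := IsNegOn.exists_of_perp hb h' he hf hW hWn
    obtain ⟨W₂, -, h2n, e2⟩ := IsNegOn.exists_of_perp hb h Submodule.mem_top Submodule.mem_top h1 h1n
    have := hν.2 ⟨W₂, rfl, h2n⟩
    omega
  refine ⟨?_, hup⟩
  obtain ⟨W, hWν, hW⟩ := hν.1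
  obtain ⟨W₁, h1, h1n, e1⟩ :=
    IsNegOn.exists_perp hb h Submodule.mem_top Submodule.mem_top le_top (show IsNegOn b W from hW)
  obtain ⟨W₂, h2, h2n, e2⟩ := IsNegOn.exists_perp hb h' he hf h1 h1n
  refine ⟨W₂, h2, h2n, ?_⟩
  have := hup W₂ h2 h2n
  omega

lemma finrank_perp₂_perp₂ (hb : ∀ v w, b v w = b w v)
    {e f e' f' : V} (h : IsHyperbolicPair b e f)
    (h' : IsHyperbolicPair b e' f') (he : e' ∈ perp₂ b ⊤ e f) (hf : f' ∈ perp₂ b ⊤ e f) :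
    finrank ℝ (perp₂ b (perp₂ b ⊤ e f) e' f') + 4 = finrank ℝ V := by
  obtain ⟨-, he1, he2⟩ := mem_perp₂.1 he
  obtain ⟨-, hf1, hf2⟩ := mem_perp₂.1 hf
  let Φ : V →ₗ[ℝ] ℝ × ℝ × ℝ × ℝ :=
    (b.flip e).prod ((b.flip f).prod ((b.flip e').prod (b.flip f')))
  have hker : LinearMap.ker Φ = perp₂ b (perp₂ b ⊤ e f) e' f' := by
    ext v
    simp [Φ, mem_perp₂, and_assoc]
  have hsurj : LinearMap.range Φ = ⊤ := by
    rw [LinearMap.range_eq_top]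
    rintro ⟨x, y, z, w⟩
    -- In a hyperbolic pair, pairing with one vector reads off the coefficient of the other.
    refine ⟨x • f + y • e + z • f' + w • e', ?_⟩
    simp [Φ, h.left, h.right, h.mul, h'.left, h'.right, h'.mul, hb f e, hb f' e', hb e e', hb e f',
      hb f e', hb f f', he1, he2, hf1, hf2]
  have := LinearMap.finrank_range_add_finrank_ker Φ
  rw [hker, hsurj, finrank_top] at this
  simp only [finrank_prod, finrank_self] at this
  omega

/-- Removing from an arbitrary `w` its components in the two planes leaves its product with `v`
unchanged, so `v` is orthogonal to everything. -/
lemma nondegenerate_perp₂_perp₂ (hb : ∀ v w, b v w = b w v)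
    {e f e' f' : V} (h : IsHyperbolicPair b e f)
    (h' : IsHyperbolicPair b e' f') (he : e' ∈ perp₂ b ⊤ e f) (hf : f' ∈ perp₂ b ⊤ e f)
    (hnd : ∀ v, (∀ w, b v w = 0) → v = 0) {v : V} (hv : v ∈ perp₂ b (perp₂ b ⊤ e f) e' f')
    (hvw : ∀ w ∈ perp₂ b (perp₂ b ⊤ e f) e' f', b v w = 0) : v = 0 := by
  obtain ⟨-, he1, he2⟩ := mem_perp₂.1 he
  obtain ⟨-, hf1, hf2⟩ := mem_perp₂.1 hf
  obtain ⟨hv', hv3, hv4⟩ := mem_perp₂.1 hv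
  obtain ⟨-, hv1, hv2⟩ := mem_perp₂.1 hv'
  refine hnd v fun w => ?_
  have := hvw (w - b w f • e - b w e • f - b w f' • e' - b w e' • f') (by
    simp [mem_perp₂, h.left, h.right, h.mul, h'.left, h'.right, h'.mul, hb f e, hb f' e', hb e e',
      hb e f', hb f e', hb f f', he1, he2, hf1, hf2])
  simpa [hv1, hv2, hv3, hv4] using this

/-- Data extracted from a lightlike hyperplane `H` with radical `R` and characteristic screen `S`:
`E` spans the radical and `ν` the lightlike transversal line. -/
structure IsLightlikeFrame (b : LinearMap.BilinForm ℝ V) (φ : V →ₗ[ℝ] V)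
    (H R S : Submodule ℝ V) (E ν : V) : Prop where
  pair : IsHyperbolicPair b E ν
  pair_map : IsHyperbolicPair b (φ E) (φ ν)
  mem_left : φ E ∈ perp₂ b ⊤ E ν
  mem_right : φ ν ∈ perp₂ b ⊤ E ν
  radical : R = ℝ ∙ E
  mem_hyperplane : ∀ v, v ∈ H ↔ b v E = 0
  screen : S = perp₂ b ⊤ E ν
  transversal : Submodule.span ℝ {ν' | b ν' ν' = 0 ∧ (∀ w ∈ S, b ν' w = 0) ∧ ∃ e ∈ R, b ν' e = 1} =
    ℝ ∙ ν

/-- A form vanishing on the screen but not on `E` is represented by a vector, which becomes null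
after adding a multiple of `E`. Skewness gives `φ ν` orthogonal to `ν`, and moves `φ` from `ν` to
`E` to give `φ ν` orthogonal to `E`. As `E` and `ν` are orthogonal to the screen, hence to `ker φ`,
`hiso` transfers the hyperbolic relations to their images. -/
lemma exists_isLightlikeFrame (hb : ∀ v w, b v w = b w v)
    (hnd : ∀ v, (∀ w, b v w = 0) → v = 0) {φ : V →ₗ[ℝ] V}
    (hskew : ∀ v w, b (φ v) w = -b v (φ w))
    (hiso : ∀ v w, (∀ k ∈ LinearMap.ker φ, b v k = 0) → b (φ v) (φ w) = b v w)
    {H R S : Submodule ℝ V} (hH : finrank ℝ H + 1 = finrank ℝ V)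
    (hR : ∀ v, v ∈ R ↔ v ∈ H ∧ ∀ w ∈ H, b v w = 0) (hR0 : R ≠ ⊥) (hsup : R ⊔ S = H)
    (hinf : R ⊓ S = ⊥) (hker : LinearMap.ker φ ≤ S) (hφR : R.map φ ≤ S) :
    ∃ E ν, IsLightlikeFrame b φ H R S E ν := by
  obtain ⟨E, hER, hE0⟩ := Submodule.exists_mem_ne_zero_of_ne_bot hR0
  obtain ⟨hEH, hEw⟩ := (hR E).1 hER
  have hSH : S ≤ H := hsup ▸ le_sup_right
  obtain ⟨w₀, hw₀⟩ : ∃ w, b E w ≠ 0 := by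
    by_contra! hc
    exact hE0 (hnd E hc)
  have hHker : H = LinearMap.ker (b E) := by
    refine Submodule.eq_of_le_of_finrank_le (fun w hw => hEw w hw) ?_
    have h1 := LinearMap.finrank_range_add_finrank_ker (b E)
    have h2 : 0 < finrank ℝ (LinearMap.range (b E)) := by
      rw [Module.finrank_pos_iff_exists_ne_zero]
      exact ⟨⟨b E w₀, w₀, rfl⟩, fun h => hw₀ (congrArg Subtype.val h)⟩
    omega
  have hmemH : ∀ v, v ∈ H ↔ b v E = 0 := fun v => by
    rw [hHker, LinearMap.mem_ker, hb]
  have hperp : ∀ v, (∀ w ∈ H, b v w = 0) → ∃ c : ℝ, c • E = v := by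
    intro v hv
    -- A form vanishing on the hyperplane `H` is determined by its value at `w₀`, which lies outside
    -- `H`.
    refine ⟨b v w₀ / b E w₀, ?_⟩
    rw [← sub_eq_zero]
    refine hnd _ fun u => ?_
    have h1 : u - (b E u / b E w₀) • w₀ ∈ H := by
      rw [hmemH, hb]
      simp [hw₀]
    have h2 := hv _ h1
    simp only [map_sub, map_smul, smul_eq_mul, sub_eq_zero] at h2
    simp only [map_sub, map_smul, LinearMap.sub_apply, LinearMap.smul_apply, smul_eq_mul, h2]
    ring
  have hRE : R = ℝ ∙ E := by
    refine le_antisymm (fun v hv => ?_) ((Submodule.span_singleton_le_iff_mem _ _).2 hER)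
    exact Submodule.mem_span_singleton.2 (hperp v ((hR v).1 hv).2)
  have hES : E ∉ S := fun h => hE0 ((Submodule.eq_bot_iff _).1 hinf E ⟨hER, h⟩)
  obtain ⟨ℓ, hℓE, hℓS⟩ := Submodule.exists_le_ker_of_notMem hES
  have hbsurj : Function.Surjective (b : V →ₗ[ℝ] Dual ℝ V) := by
    refine (LinearMap.injective_iff_surjective_of_finrank_eq_finrank
      (Subspace.dual_finrank_eq (K := ℝ) (V := V)).symm).1 ?_
    rw [← LinearMap.ker_eq_bot, Submodule.eq_bot_iff]
    intro v hv
    exact hnd v fun w => by rw [LinearMap.mem_ker.1 hv]; rfl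
  obtain ⟨w, hw⟩ := hbsurj ((ℓ E)⁻¹ • ℓ)
  have hwE : b w E = 1 := by simp [hw, hℓE]
  have hwS : ∀ s ∈ S, b w s = 0 := fun s hs => by simp [hw, LinearMap.mem_ker.1 (hℓS hs)]
  have hEE : b E E = 0 := hEw E hEH
  have hES' : ∀ s ∈ S, b E s = 0 := fun s hs => hEw s (hSH hs)
  -- Since `E` is null and orthogonal to `S`, the correction keeps the products with `E` and `S` and
  -- cancels the square of `w`.
  set ν := w - (1 / 2 * b w w) • E with hν
  have hνS : ∀ s ∈ S, b ν s = 0 := fun s hs => by simp [hν, hwS s hs, hES' s hs]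
  have hνE : b ν E = 1 := by simp [hν, hwE, hEE]
  have hνν : b ν ν = 0 := by
    have : b ν w = 1 / 2 * b w w := by simp [hν, hb E w, hwE]; ring
    conv_lhs => rw [hν, map_sub, map_smul, ← hν, this, hνE]
    simp
  have hpair : IsHyperbolicPair b E ν := ⟨hEE, hνν, by rw [hb, hνE]⟩
  have hS : S = perp₂ b ⊤ E ν := by
    ext v
    rw [mem_perp₂]
    constructor
    · intro hv
      exact ⟨trivial, by rw [hb, hES' v hv], by rw [hb, hνS v hv]⟩
    · rintro ⟨-, h1, h2⟩
      have hvH : v ∈ R ⊔ S := by rw [hsup, hmemH, h1]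
      obtain ⟨r, hr, s, hs, rfl⟩ := Submodule.mem_sup.1 hvH
      rw [hRE] at hr
      obtain ⟨c, rfl⟩ := Submodule.mem_span_singleton.1 hr
      have hc : c = 0 := by simpa [hpair.mul, hb s ν, hνS s hs] using h2
      simpa [hc] using hs
  have hφE : φ E ∈ S := hφR ⟨E, hER, rfl⟩
  have hφν : φ ν ∈ S := by
    rw [hS, mem_perp₂]
    refine ⟨trivial, by rw [hskew, hνS _ hφE, neg_zero], ?_⟩
    have := hskew ν ν
    rw [hb ν] at this
    linarith
  have hkE : ∀ k ∈ LinearMap.ker φ, b E k = 0 := fun k hk => hES' k (hker hk)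
  have hkν : ∀ k ∈ LinearMap.ker φ, b ν k = 0 := fun k hk => hνS k (hker hk)
  refine ⟨E, ν, hpair, ⟨by rw [hiso _ _ hkE, hEE], by rw [hiso _ _ hkν, hνν],
    by rw [hiso _ _ hkE, hpair.mul]⟩, hS ▸ hφE, hS ▸ hφν, hRE, hmemH, hS, ?_⟩
  refine le_antisymm (Submodule.span_le.2 ?_) ?_
  · rintro ν' ⟨h1, h2, e, he, h3⟩
    -- Any other candidate `ν'` differs from a multiple of `ν` by a vector orthogonal to `H`, hence
    -- by `t • E`. Its square is `2 * t * b ν' E`, so nullity forces `t = 0`.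
    obtain ⟨t, ht⟩ := hperp (ν' - b ν' E • ν) (by
      rw [← hsup]
      intro x hx
      obtain ⟨r, hr, s, hs, rfl⟩ := Submodule.mem_sup.1 hx
      rw [hRE] at hr
      obtain ⟨c, rfl⟩ := Submodule.mem_span_singleton.1 hr
      simp [h2 s hs, hνS s hs, hνE, mul_comm c])
    have hν' : ν' = t • E + b ν' E • ν := by rw [ht]; abel
    rw [hRE] at he
    obtain ⟨c, rfl⟩ := Submodule.mem_span_singleton.1 he
    have ha : b ν' E ≠ 0 := fun h0 => by simp [h0] at h3
    have h4 : b ν' ν' = 2 * t * b ν' E := by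
      set a := b ν' E
      rw [hν']
      simp only [map_add, map_smul, LinearMap.add_apply, LinearMap.smul_apply, hEE, hνν, hνE,
        hpair.mul, smul_eq_mul]
      ring
    have ht0 : t = 0 := by
      rw [h1] at h4
      simpa [ha] using h4.symm
    rw [ht0, zero_smul, zero_add] at hν'
    exact Submodule.mem_span_singleton.2 ⟨_, hν'.symm⟩
  · rw [Submodule.span_singleton_le_iff_mem]
    exact Submodule.subset_span ⟨hνν, hνS, E, hER, hνE⟩

end LinearAlgebra

/-! ### Pointwise identities of a metric g.f.f-structure. -/

section Pointwise

variable {k r : ℕ} {N : Type*} [TopologicalSpace N] [ChartedSpace (EuclideanSpace ℝ (Fin k)) N]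

instance finiteDimensional_tangentSpace (x : N) : FiniteDimensional ℝ (TangentSpace (𝓡 k) x) :=
  inferInstanceAs (FiniteDimensional ℝ (EuclideanSpace ℝ (Fin k)))

lemma finrank_tangentSpace (x : N) : Module.finrank ℝ (TangentSpace (𝓡 k) x) = k :=
  (finrank_euclideanSpace_fin : Module.finrank ℝ (EuclideanSpace ℝ (Fin k)) = k)

variable [IsManifold (𝓡 k) ∞ N]

/-- The bilinear form of a metric at a point. -/
def SemiRiemannianMetric.bilin (g : SemiRiemannianMetric k N) (x : N) :
    LinearMap.BilinForm ℝ (TangentSpace (𝓡 k) x) :=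
  ContinuousLinearMap.coeLM ℝ ∘ₗ (g.inner x).toLinearMap

@[simp]
lemma SemiRiemannianMetric.bilin_apply (g : SemiRiemannianMetric k N) (x : N)
    (v w : TangentSpace (𝓡 k) x) : g.bilin x v w = g.inner x v w := rfl

namespace MetricGFF

variable (S : MetricGFF k N r)

lemma φ_ξ (x : N) (α : Fin r) : S.φ x (S.ξ α x) = 0 := by
  have : S.ξ α x ∈ (S.φ x).ker := by
    rw [S.ker_φ]
    exact Submodule.subset_span ⟨α, rfl⟩
  exact this

/-- Expanding the cube of `φ` in two ways shows that the combination of the `ξ_β` with coefficients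
`η^β (φ v)` vanishes. -/
lemma η_φ (x : N) (α : Fin r) (v : TangentSpace (𝓡 k) x) : S.η α x (S.φ x v) = 0 := by
  have h1 := S.φ_sq x (S.φ x v)
  rw [S.φ_sq x v] at h1
  simp only [map_add, map_neg, map_sum, map_smul, S.φ_ξ, smul_zero, Finset.sum_const_zero,
    add_zero, left_eq_add] at h1
  have h2 := congrArg (S.η α x) h1
  simpa [S.η_ξ] using h2

lemma inner_ξ_right (x : N) (α : Fin r) (v : TangentSpace (𝓡 k) x) :
    S.inner x v (S.ξ α x) = S.ε α * S.η α x v := by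
  have h := S.compatible x v (S.ξ α x)
  rw [S.φ_ξ, map_zero] at h
  simp only [S.η_ξ, mul_ite, mul_one, mul_zero, Finset.sum_ite_eq', Finset.mem_univ, if_true] at h
  linarith

/-- Compatibility for `φ v` and `w`: the correction vanishes because `η ∘ φ = 0`, and in `φ² v` the
`ξ`-terms are orthogonal to `φ w` for the same reason. -/
lemma inner_φ_left (x : N) (v w : TangentSpace (𝓡 k) x) :
    S.inner x (S.φ x v) w = -S.inner x v (S.φ x w) := by
  have h := S.compatible x (S.φ x v) w
  rw [S.φ_sq] at h
  simp only [S.η_φ, mul_zero, zero_mul, Finset.sum_const_zero, sub_zero, map_add, map_neg,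
    map_sum, map_smul, add_apply, neg_apply, sum_apply, smul_apply] at h
  rw [← h]
  have : ∀ α, S.inner x (S.ξ α x) (S.φ x w) = 0 := fun α => by
    rw [S.symm, S.inner_ξ_right, S.η_φ, mul_zero]
  simp [this]

lemma inner_φ_φ (x : N) (v w : TangentSpace (𝓡 k) x)
    (hv : ∀ u ∈ (S.φ x).ker, S.inner x v u = 0) :
    S.inner x (S.φ x v) (S.φ x w) = S.inner x v w := by
  have : ∀ α, S.ε α * S.η α x v = 0 := fun α => by
    rw [← S.inner_ξ_right]
    exact hv _ (S.φ_ξ x α)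
  simp [S.compatible, this]

end MetricGFF

end Pointwise

/-! ### The decomposition of the tangent spaces along the hypersurface. -/

section Frames

variable {k m r : ℕ}
  {N : Type*} [TopologicalSpace N] [ChartedSpace (EuclideanSpace ℝ (Fin k)) N]
  [IsManifold (𝓡 k) ∞ N]
  {M : Type*} [TopologicalSpace M] [ChartedSpace (EuclideanSpace ℝ (Fin m)) M]
  {S : MetricGFF k N r} {j : M → N} {Sc : ∀ p : M, Submodule ℝ (TangentSpace (𝓡 m) p)}

/-- `E`, `ν` span the image of the radical and the lightlike transversal line at `p`. -/
def IsFrameAt (S : MetricGFF k N r) (j : M → N)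
    (Sc : ∀ p : M, Submodule ℝ (TangentSpace (𝓡 m) p)) (p : M)
    (E ν : TangentSpace (𝓡 k) (j p)) : Prop :=
  IsLightlikeFrame (S.bilin (j p)) (S.φ (j p)).toLinearMap (mfderiv (𝓡 m) (𝓡 k) j p).range
    ((radical S.toSemiRiemannianMetric j p).map (mfderiv (𝓡 m) (𝓡 k) j p).toLinearMap)
    ((Sc p).map (mfderiv (𝓡 m) (𝓡 k) j p).toLinearMap) E ν

/-- Frames are chosen point by point; they serve only pointwise statements, so they need not vary
smoothly. -/
lemma exists_isFrameAt [IsManifold (𝓡 m) ∞ M] (hj : IsCharacteristicHypersurface (m := m) S j)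
    (hSc : IsCharacteristicScreen S j Sc) (p : M) : ∃ E ν, IsFrameAt S j Sc p E ν := by
  have hinj := (hasRetractions_of_isImmersion hj.immersion).mfderiv_injective p
  set A := (mfderiv (𝓡 m) (𝓡 k) j p).toLinearMap with hA
  have hAinj : Function.Injective A := hinj
  refine exists_isLightlikeFrame (fun v w => S.symm _ v w) (fun v h => S.nondegenerate _ v h)
    (fun v w => S.inner_φ_left _ v w) (fun v w h => S.inner_φ_φ _ v w h) ?_ ?_ ?_ ?_ ?_
    (hSc.ker_φ p) ?_
  · have h1 := LinearMap.finrank_range_of_inj hAinj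
    rw [finrank_tangentSpace] at h1
    exact (congrArg (· + 1) h1).trans (hj.codim.trans (finrank_tangentSpace (j p)).symm)
  · intro v
    constructor
    · rintro ⟨e, he, rfl⟩
      refine ⟨⟨e, rfl⟩, ?_⟩
      rintro _ ⟨w, rfl⟩
      exact he w
    · rintro ⟨⟨e, rfl⟩, h⟩
      exact ⟨e, fun w => h _ ⟨w, rfl⟩, rfl⟩
  · intro h0
    refine hj.degenerate p ((Submodule.eq_bot_iff _).2 fun e he => hAinj ?_)
    rw [map_zero]
    exact (Submodule.eq_bot_iff _).1 h0 _ ⟨e, he, rfl⟩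
  · rw [← Submodule.map_sup, (hSc.isCompl p).sup_eq_top, Submodule.map_top]
  · rw [← Submodule.map_inf _ hAinj, (hSc.isCompl p).inf_eq_bot, Submodule.map_bot]
  · rintro _ ⟨_, ⟨e, he, rfl⟩, rfl⟩
    exact hSc.φ_radical p e he

variable {p : M} {E ν : TangentSpace (𝓡 k) (j p)}

lemma IsFrameAt.ltr_eq (h : IsFrameAt S j Sc p E ν) :
    ltr S.toSemiRiemannianMetric j Sc p = Submodule.span ℝ {ν} := by
  rw [← h.transversal, ltr]
  congr 1
  ext v
  simp

lemma IsFrameAt.mem_phiPlane (h : IsFrameAt S j Sc p E ν) {v : TangentSpace (𝓡 k) (j p)} :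
    v ∈ phiPlane S j Sc p ↔ ∃ a c : ℝ, a • S.φ (j p) E + c • S.φ (j p) ν = v := by
  rw [phiPlane, h.ltr_eq, h.radical, ← Submodule.span_union, Submodule.map_span,
    Set.singleton_union, Set.image_pair, Submodule.mem_span_pair]
  rfl

/-- The screen is itself the complement of `E` and `ν`, so a complement taken inside it becomes a
complement in the whole ambient tangent space. -/
lemma IsFrameAt.map_distD₀ (h : IsFrameAt S j Sc p E ν) :
    (distD₀ S j Sc p).map (mfderiv (𝓡 m) (𝓡 k) j p).toLinearMap =
      perp₂ (S.bilin (j p)) (perp₂ (S.bilin (j p)) ⊤ E ν) (S.φ (j p) E) (S.φ (j p) ν) := by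
  ext v
  rw [mem_perp₂, ← h.screen]
  constructor
  · rintro ⟨u, ⟨hu, hu'⟩, rfl⟩
    refine ⟨⟨u, hu, rfl⟩, hu' _ (h.mem_phiPlane.2 ⟨1, 0, by simp⟩),
      hu' _ (h.mem_phiPlane.2 ⟨0, 1, by simp⟩)⟩
  · rintro ⟨⟨u, hu, rfl⟩, h1, h2⟩
    refine ⟨u, ⟨hu, fun w hw => ?_⟩, rfl⟩
    obtain ⟨a, c, rfl⟩ := h.mem_phiPlane.1 hw
    simp only [SemiRiemannianMetric.bilin_apply, ContinuousLinearMap.coe_coe] at h1 h2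
    simp [h1, h2]

/-- The tangent hyperplane is the complement of `E` and `g (ν, E) = 1`, so subtracting `g (v, E) ν`
makes `v` tangent. -/
lemma IsFrameAt.isCompl_ltr (h : IsFrameAt S j Sc p E ν) :
    IsCompl (mfderiv (𝓡 m) (𝓡 k) j p).range (ltr S.toSemiRiemannianMetric j Sc p) := by
  have hνE : S.inner (j p) ν E = 1 := by rw [S.symm]; exact h.pair.mul
  rw [h.ltr_eq]
  refine IsCompl.of_le ?_ ?_
  · rintro v ⟨hv, hv'⟩
    obtain ⟨c, rfl⟩ := Submodule.mem_span_singleton.1 hv'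
    have h1 := (h.mem_hyperplane _).1 hv
    have hc : c = 0 := by simpa [hνE] using h1
    simp [hc]
  · intro v _
    refine Submodule.mem_sup.2 ⟨v - S.inner (j p) v E • ν, ?_, _,
      Submodule.mem_span_singleton.2 ⟨S.inner (j p) v E, rfl⟩, by simp⟩
    rw [h.mem_hyperplane]
    simp [hνE]

/-- The image of `F` consists of combinations of `φ E`, `φ ν` and `E`. -/
lemma IsFrameAt.mem_distF (h : IsFrameAt S j Sc p E ν)
    (hinj : Function.Injective (mfderiv (𝓡 m) (𝓡 k) j p)) {v : TangentSpace (𝓡 m) p} :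
    v ∈ distF S j Sc p ↔ ∃ a c t : ℝ, a • S.φ (j p) E + c • S.φ (j p) ν + t • E =
      mfderiv (𝓡 m) (𝓡 k) j p v := by
  -- The plane is tangent to `M`, so the `comap` in `distF` loses none of it.
  have hle : ∀ w ∈ phiPlane S j Sc p, w ∈ (mfderiv (𝓡 m) (𝓡 k) j p).range := by
    intro w hw
    obtain ⟨a, c, rfl⟩ := h.mem_phiPlane.1 hw
    rw [h.mem_hyperplane]
    have h1 : S.inner (j p) (S.φ (j p) E) E = 0 := (mem_perp₂.1 h.mem_left).2.1
    have h2 : S.inner (j p) (S.φ (j p) ν) E = 0 := (mem_perp₂.1 h.mem_right).2.1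
    simp [h1, h2]
  have hrad : ∀ e, e ∈ radical S.toSemiRiemannianMetric j p ↔
      ∃ t : ℝ, t • E = mfderiv (𝓡 m) (𝓡 k) j p e := by
    intro e
    rw [← Submodule.mem_span_singleton, ← h.radical]
    refine ⟨fun he => ⟨e, he, rfl⟩, ?_⟩
    rintro ⟨e', he', h'⟩
    exact hinj h' ▸ he'
  rw [distF, Submodule.mem_sup]
  constructor
  · rintro ⟨u, hu, e, he, rfl⟩
    obtain ⟨a, c, hac⟩ := h.mem_phiPlane.1 hu
    obtain ⟨t, ht⟩ := (hrad e).1 he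
    exact ⟨a, c, t, by rw [hac, ht, map_add]; rfl⟩
  · rintro ⟨a, c, t, hv⟩
    obtain ⟨u, hu⟩ := hle _ (h.mem_phiPlane.2 ⟨a, c, rfl⟩)
    refine ⟨u, ?_, v - u, (hrad _).2 ⟨t, ?_⟩, by simp⟩
    · exact h.mem_phiPlane.2 ⟨a, c, hu.symm⟩
    · have hu' : mfderiv (𝓡 m) (𝓡 k) j p u = a • S.φ (j p) E + c • S.φ (j p) ν := hu
      rw [map_sub, ← hv, hu']
      abel

lemma IsFrameAt.isCompl_distF (h : IsFrameAt S j Sc p E ν)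
    (hinj : Function.Injective (mfderiv (𝓡 m) (𝓡 k) j p)) :
    IsCompl (distD₀ S j Sc p) (distF S j Sc p) := by
  have hD : ∀ v, v ∈ distD₀ S j Sc p ↔ mfderiv (𝓡 m) (𝓡 k) j p v ∈
      perp₂ (S.bilin (j p)) (perp₂ (S.bilin (j p)) ⊤ E ν) (S.φ (j p) E) (S.φ (j p) ν) := by
    intro v
    rw [← h.map_distD₀]
    refine ⟨fun he => ⟨v, he, rfl⟩, ?_⟩
    rintro ⟨e', he', h'⟩
    exact hinj h' ▸ he'
  have e1 : S.inner (j p) (S.φ (j p) E) E = 0 := (mem_perp₂.1 h.mem_left).2.1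
  have e2 : S.inner (j p) (S.φ (j p) ν) E = 0 := (mem_perp₂.1 h.mem_right).2.1
  have e3 : S.inner (j p) (S.φ (j p) E) ν = 0 := (mem_perp₂.1 h.mem_left).2.2
  have e4 : S.inner (j p) (S.φ (j p) ν) ν = 0 := (mem_perp₂.1 h.mem_right).2.2
  have e1' : S.inner (j p) E (S.φ (j p) E) = 0 := by rw [S.symm, e1]
  have e2' : S.inner (j p) E (S.φ (j p) ν) = 0 := by rw [S.symm, e2]
  have e5 : S.inner (j p) E E = 0 := h.pair.left
  have e6 : S.inner (j p) E ν = 1 := h.pair.mul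
  have e7 : S.inner (j p) (S.φ (j p) E) (S.φ (j p) E) = 0 := h.pair_map.left
  have e8 : S.inner (j p) (S.φ (j p) E) (S.φ (j p) ν) = 1 := h.pair_map.mul
  have e9 : S.inner (j p) (S.φ (j p) ν) (S.φ (j p) E) = 1 := by rw [S.symm, e8]
  have e10 : S.inner (j p) (S.φ (j p) ν) (S.φ (j p) ν) = 0 := h.pair_map.right
  refine IsCompl.of_le ?_ ?_
  · rintro v ⟨hv, hv'⟩
    obtain ⟨a, c, t, hact⟩ := (h.mem_distF hinj).1 hv'
    have h1 := (hD v).1 hv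
    rw [← hact, mem_perp₂, mem_perp₂] at h1
    obtain ⟨⟨-, -, ht⟩, hc, ha⟩ := h1
    have ht : t = 0 := by simpa [e3, e4, e6] using ht
    have hc : c = 0 := by simpa [e7, e9, e1'] using hc
    have ha : a = 0 := by simpa [e8, e10, e2'] using ha
    refine (Submodule.mem_bot ℝ).2 (hinj ?_)
    rw [← hact, map_zero]
    simp [ht, hc, ha]
  · intro v _
    set w := mfderiv (𝓡 m) (𝓡 k) j p v with hw
    have hwE : S.inner (j p) w E = 0 := (h.mem_hyperplane w).1 ⟨v, rfl⟩
    -- The component of `w` in the two hyperbolic planes; its `ν`-coefficient `g (w, E)` vanishes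
    -- because `w` is tangent.
    have hz : S.inner (j p) w (S.φ (j p) ν) • S.φ (j p) E +
        S.inner (j p) w (S.φ (j p) E) • S.φ (j p) ν + S.inner (j p) w ν • E ∈
        (mfderiv (𝓡 m) (𝓡 k) j p).range := by
      rw [h.mem_hyperplane]
      simp [e1, e2, e5]
    obtain ⟨z, hz⟩ := hz
    have hz' : mfderiv (𝓡 m) (𝓡 k) j p z = _ := hz
    refine Submodule.mem_sup.2 ⟨v - z, ?_, z, (h.mem_distF hinj).2 ⟨_, _, _, hz.symm⟩, by simp⟩
    rw [hD, map_sub, ← hw, hz', mem_perp₂, mem_perp₂]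
    simp [e1, e2, e3, e4, e1', e2', e5, e6, e7, e8, e9, e10, hwE]

end Frames

/-! ### Restricting the structure tensors to a submanifold. -/

section Restriction

variable {d k r : ℕ}
  {L : Type*} [TopologicalSpace L] [ChartedSpace (EuclideanSpace ℝ (Fin d)) L]
  [IsManifold (𝓡 d) ∞ L]
  {N : Type*} [TopologicalSpace N] [ChartedSpace (EuclideanSpace ℝ (Fin k)) N]
  [IsManifold (𝓡 k) ∞ N] {f : L → N}

lemma HasRetractions.contMDiffAt_mfderiv (hf : HasRetractions (d := d) (m := k) f) {x : L}
    {X : ∀ y : L, TangentSpace (𝓡 d) y}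
    (hX : ContMDiffAt (𝓡 d) (𝓡 d).tangent ∞ (fun y => (⟨y, X y⟩ : TangentBundle (𝓡 d) L)) x) :
    ContMDiffAt (𝓡 d) (𝓡 k).tangent ∞
      (fun y => (⟨f y, mfderiv (𝓡 d) (𝓡 k) f y (X y)⟩ : TangentBundle (𝓡 k) N)) x :=
  contMDiffAt_mfderiv_apply (b := fun y => y) hf.contMDiff.contMDiffAt hX

/-- A vector field whose image under `f` is smooth along `f` is smooth. -/
lemma HasRetractions.contMDiffAt_of_mfderiv (hf : HasRetractions (d := d) (m := k) f) {x : L}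
    {X : ∀ y : L, TangentSpace (𝓡 d) y}
    (hX : ContMDiffAt (𝓡 d) (𝓡 k).tangent ∞
      (fun y => (⟨f y, mfderiv (𝓡 d) (𝓡 k) f y (X y)⟩ : TangentBundle (𝓡 k) N)) x) :
    ContMDiffAt (𝓡 d) (𝓡 d).tangent ∞ (fun y => (⟨y, X y⟩ : TangentBundle (𝓡 d) L)) x := by
  obtain ⟨ρ, hρ, e⟩ := hf.exists_retraction x
  -- Near `x` the field is recovered from its image by the derivative of `ρ`.
  refine (contMDiffAt_mfderiv_apply (b := f) hρ hX).congr_of_eventuallyEq ?_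
  have hρd : ∀ᶠ y in 𝓝 x, MDifferentiableAt (𝓡 k) (𝓡 d) ρ (f y) :=
    hf.contMDiff.continuous.continuousAt.eventually
      ((contMDiffAt_iff_contMDiffAt_nhds (by simp)).1
        (hρ.of_le (m := 1) (WithTop.coe_le_coe.2 le_top)) |>.mono
          fun u hu => hu.mdifferentiableAt (by simp))
  filter_upwards [e.eventually_nhds, hρd] with y hy hy'
  have h1 := mfderiv_retraction (hf.mdifferentiableAt y) hy' hy (X y)
  -- The points `ρ (f y)` and `y` are equal but not definitionally, hence the variable base point.
  have h2 : ∀ (a : L) (u w : EuclideanSpace ℝ (Fin d)), a = y → u = w →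
      (⟨y, w⟩ : TangentBundle (𝓡 d) L) = ⟨a, u⟩ := by
    rintro a u w rfl rfl
    rfl
  exact h2 _ _ _ hy.self_of_nhds h1

/-- The pullback of a bilinear form. -/
def pullbackInner (g : SemiRiemannianMetric k N) (f : L → N) (x : L) :
    TangentSpace (𝓡 d) x →L[ℝ] TangentSpace (𝓡 d) x →L[ℝ] ℝ :=
  (ContinuousLinearMap.precomp ℝ (mfderiv (𝓡 d) (𝓡 k) f x)).comp
    ((g.inner (f x)).comp (mfderiv (𝓡 d) (𝓡 k) f x))

lemma pullbackInner_apply (g : SemiRiemannianMetric k N) (x : L) (v w : TangentSpace (𝓡 d) x) :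
    pullbackInner g f x v w =
      g.inner (f x) (mfderiv (𝓡 d) (𝓡 k) f x v) (mfderiv (𝓡 d) (𝓡 k) f x w) := rfl

lemma HasRetractions.contMDiff_pullbackInner (hf : HasRetractions (d := d) (m := k) f)
    (g : SemiRiemannianMetric k N) :
    ContMDiff (𝓡 d)
      ((𝓡 d).prod 𝓘(ℝ, EuclideanSpace ℝ (Fin d) →L[ℝ] EuclideanSpace ℝ (Fin d) →L[ℝ] ℝ)) ∞
      (fun x => TotalSpace.mk' (EuclideanSpace ℝ (Fin d) →L[ℝ] EuclideanSpace ℝ (Fin d) →L[ℝ] ℝ)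
        (E := fun x : L => TangentSpace (𝓡 d) x →L[ℝ] TangentSpace (𝓡 d) x →L[ℝ] ℝ) x
        (pullbackInner g f x)) := by
  intro x
  refine contMDiffAt_hom_of_apply (F := EuclideanSpace ℝ (Fin d) →L[ℝ] ℝ)
    (V := fun x : L => TangentSpace (𝓡 d) x →L[ℝ] Bundle.Trivial L ℝ x) _ fun X hX => ?_
  refine contMDiffAt_hom_of_apply (F := ℝ) (V := Bundle.Trivial L ℝ) _ fun Y hY => ?_
  have h1 := ContMDiffAt.clm_bundle_apply₂
    (F₁ := EuclideanSpace ℝ (Fin k)) (F₂ := EuclideanSpace ℝ (Fin k)) (F₃ := ℝ)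
    (E₁ := (TangentSpace (𝓡 k) : N → Type _)) (E₂ := (TangentSpace (𝓡 k) : N → Type _))
    (E₃ := Bundle.Trivial N ℝ) (b := f) ((g.contMDiff (f x)).comp x hf.contMDiff.contMDiffAt)
    (hf.contMDiffAt_mfderiv hX) (hf.contMDiffAt_mfderiv hY)
  exact contMDiffAt_totalSpace.2 ⟨contMDiffAt_id, (contMDiffAt_totalSpace.1 h1).2⟩

/-- A non-degenerate submanifold whose tangent spaces are `φ`-invariant and contain the `ξ_α`
inherits a metric g.f.f-structure. -/
lemma HasRetractions.exists_isRestriction (hf : HasRetractions (d := d) (m := k) f)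
    (S : MetricGFF k N r) (hr : r < d)
    (hφ : ∀ (x : L) (v : TangentSpace (𝓡 d) x), ∃ w : TangentSpace (𝓡 d) x,
      mfderiv (𝓡 d) (𝓡 k) f x w = S.φ (f x) (mfderiv (𝓡 d) (𝓡 k) f x v))
    (hξ : ∀ α (x : L), ∃ w : TangentSpace (𝓡 d) x,
      mfderiv (𝓡 d) (𝓡 k) f x w = S.ξ α (f x))
    (hnd : ∀ (x : L) (v : TangentSpace (𝓡 d) x), (∀ w : TangentSpace (𝓡 d) x,
      pullbackInner (d := d) S.toSemiRiemannianMetric f x v w = 0) → v = 0) (ν : ℕ)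
    (hν : ∀ x : L, IsIndexOf (fun v w : TangentSpace (𝓡 d) x =>
      pullbackInner (d := d) S.toSemiRiemannianMetric f x v w) ν) :
    ∃ T : MetricGFF d L r, IsRestriction f S T ∧ T.index = ν := by
  have hleft : ∀ x, ∃ ℓ : TangentSpace (𝓡 k) (f x) →L[ℝ] TangentSpace (𝓡 d) x,
      ∀ v, ℓ (mfderiv (𝓡 d) (𝓡 k) f x v) = v := fun x => by
    obtain ⟨ρ, hρ, e⟩ := hf.exists_retraction x
    exact ⟨mfderiv (𝓡 k) (𝓡 d) ρ (f x),
      mfderiv_retraction (hf.mdifferentiableAt x) (hρ.mdifferentiableAt (by simp)) e⟩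
  choose ℓ hℓ using hleft
  -- By invariance, `φ` maps the range of the derivative to itself, so the choice of the left
  -- inverse `ℓ` does not matter.
  let φ : ∀ x : L, TangentSpace (𝓡 d) x →L[ℝ] TangentSpace (𝓡 d) x := fun x =>
    (ℓ x).comp ((S.φ (f x)).comp (mfderiv (𝓡 d) (𝓡 k) f x))
  choose ξ hξ using hξ
  let η : Fin r → ∀ x : L, TangentSpace (𝓡 d) x →L[ℝ] ℝ := fun α x =>
    (S.η α (f x)).comp (mfderiv (𝓡 d) (𝓡 k) f x)
  have hφ : ∀ x v, mfderiv (𝓡 d) (𝓡 k) f x (φ x v) =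
      S.φ (f x) (mfderiv (𝓡 d) (𝓡 k) f x v) := fun x v => by
    obtain ⟨w, hw⟩ := hφ x v
    have : φ x v = w := by
      change ℓ x (S.φ (f x) (mfderiv (𝓡 d) (𝓡 k) f x v)) = w
      rw [← hw, hℓ]
    rw [this, hw]
  have hφ_sq : ∀ x v, φ x (φ x v) = -v + ∑ α, η α x v • ξ α x := fun x v => by
    apply hf.mfderiv_injective x
    rw [hφ, hφ, S.φ_sq]
    simp [hξ, η]
  have hηξ : ∀ α β x, η α x (ξ β x) = if α = β then 1 else 0 := fun α β x => by
    change S.η α (f x) (mfderiv (𝓡 d) (𝓡 k) f x (ξ β x)) = _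
    rw [hξ, S.η_ξ]
  have hker : ∀ x, (φ x).ker = Submodule.span ℝ (Set.range fun α => ξ α x) := fun x => by
    refine le_antisymm (fun v hv => ?_) (Submodule.span_le.2 ?_)
    · have hv' : φ x v = 0 := hv
      have h1 := hφ_sq x v
      rw [hv', map_zero] at h1
      rw [(neg_add_eq_zero.1 h1.symm)]
      exact Submodule.sum_mem _ fun α _ =>
        Submodule.smul_mem _ _ (Submodule.subset_span ⟨α, rfl⟩)
    · rintro _ ⟨α, rfl⟩
      change φ x (ξ α x) = 0
      apply hf.mfderiv_injective x
      rw [hφ, hξ, S.φ_ξ, map_zero]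
  have hkerrank : ∀ x, Module.finrank ℝ (φ x).ker = r := fun x => by
    have hli : LinearIndependent ℝ fun α => ξ α x := by
      rw [Fintype.linearIndependent_iff]
      intro c hc α
      have := congrArg (η α x) hc
      simpa [hηξ] using this
    rw [hker, finrank_span_eq_card hli, Fintype.card_fin]
  have hrank : ∀ x, Module.finrank ℝ (φ x).range + r = d := fun x => by
    have := LinearMap.finrank_range_add_finrank_ker (φ x).toLinearMap
    rw [hkerrank x, finrank_tangentSpace] at this
    exact this
  refine ⟨{
    inner := pullbackInner S.toSemiRiemannianMetric f
    symm := fun x v w => S.symm _ _ _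
    nondegenerate := hnd
    contMDiff := hf.contMDiff_pullbackInner _
    index := ν
    isIndexOf := hν
    φ := φ
    ξ := ξ
    η := η
    ε := S.ε
    φ_contMDiff := fun x => ?_
    ξ_contMDiff := fun α x => ?_
    η_contMDiff := fun α x => ?_
    φ_ne_zero := fun x h0 => ?_
    φ_constant_rank := ⟨d - r, fun x => by have := hrank x; omega⟩
    ker_φ := hker
    η_ξ := hηξ
    φ_sq := hφ_sq
    ε_sign := S.ε_sign
    inner_ξ := fun α x => ?_
    compatible := fun x v w => ?_ }, ⟨fun _ _ _ => rfl, hφ, hξ, fun _ _ _ => rfl, rfl⟩, rfl⟩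
  · refine contMDiffAt_hom_of_apply (F := EuclideanSpace ℝ (Fin d))
      (V := (TangentSpace (𝓡 d) : L → Type _)) _ fun X hX => ?_
    apply hf.contMDiffAt_of_mfderiv
    simp only [hφ]
    exact ContMDiffAt.clm_bundle_apply
      (F₁ := EuclideanSpace ℝ (Fin k)) (F₂ := EuclideanSpace ℝ (Fin k))
      (E₁ := (TangentSpace (𝓡 k) : N → Type _)) (E₂ := (TangentSpace (𝓡 k) : N → Type _))
      (b := f) ((S.φ_contMDiff (f x)).comp x hf.contMDiff.contMDiffAt) (hf.contMDiffAt_mfderiv hX)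
  · apply hf.contMDiffAt_of_mfderiv
    simp only [hξ]
    exact (S.ξ_contMDiff α (f x)).comp x hf.contMDiff.contMDiffAt
  · refine contMDiffAt_hom_of_apply (F := ℝ) (V := Bundle.Trivial L ℝ) _ fun X hX => ?_
    have h1 := ContMDiffAt.clm_bundle_apply
      (F₁ := EuclideanSpace ℝ (Fin k)) (F₂ := ℝ)
      (E₁ := (TangentSpace (𝓡 k) : N → Type _)) (E₂ := Bundle.Trivial N ℝ)
      (b := f) ((S.η_contMDiff α (f x)).comp x hf.contMDiff.contMDiffAt)
      (hf.contMDiffAt_mfderiv hX)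
    exact contMDiffAt_totalSpace.2 ⟨contMDiffAt_id, (contMDiffAt_totalSpace.1 h1).2⟩
  -- If `φ` vanished, its kernel of dimension `r` would be the whole tangent space, of dimension `d
  -- > r`.
  · have h1 := hkerrank x
    have h2 : (φ x).ker = ⊤ := (Submodule.eq_top_iff').2 fun v => by
      change φ x v = 0
      rw [h0]
      rfl
    rw [h2, finrank_top, finrank_tangentSpace] at h1
    omega
  · rw [pullbackInner_apply, hξ, S.inner_ξ]
  · rw [pullbackInner_apply, pullbackInner_apply, hφ, hφ, S.compatible]
    rfl

/-- An `S`-structure restricts to an `S`-structure. -/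
lemma IsRestriction.isSStructure (hf : HasRetractions (d := d) (m := k) f)
    {S : MetricGFF k N r} {T : MetricGFF d L r} (hT : IsRestriction f S T)
    (hS : S.IsSStructure) : T.IsSStructure := by
  intro x X Y hX hY
  obtain ⟨X', hX', eX⟩ := hf.exists_extension hX
  obtain ⟨Y', hY', eY⟩ := hf.exists_extension hY
  have hfs : ContMDiffAt (𝓡 d) (𝓡 k) ∞ f x := hf.contMDiff.contMDiffAt
  have hTφ : ∀ Z : ∀ y : L, TangentSpace (𝓡 d) y,
      MDifferentiableAt (𝓡 d) (𝓡 d).tangent (fun y => (⟨y, Z y⟩ : TangentBundle (𝓡 d) L)) x →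
      MDifferentiableAt (𝓡 d) (𝓡 d).tangent
        (fun y => (⟨y, T.φ y (Z y)⟩ : TangentBundle (𝓡 d) L)) x := fun Z hZ =>
    MDifferentiableAt.clm_bundle_apply
      (F₁ := EuclideanSpace ℝ (Fin d)) (F₂ := EuclideanSpace ℝ (Fin d))
      (E₁ := (TangentSpace (𝓡 d) : L → Type _)) (E₂ := (TangentSpace (𝓡 d) : L → Type _))
      (b := fun y => y) ((T.φ_contMDiff x).mdifferentiableAt (by simp)) hZ
  have hSφ : ∀ Z : ∀ y : N, TangentSpace (𝓡 k) y,
      MDifferentiableAt (𝓡 k) (𝓡 k).tangent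
        (fun y => (⟨y, Z y⟩ : TangentBundle (𝓡 k) N)) (f x) →
      MDifferentiableAt (𝓡 k) (𝓡 k).tangent
        (fun y => (⟨y, S.φ y (Z y)⟩ : TangentBundle (𝓡 k) N)) (f x) := fun Z hZ =>
    MDifferentiableAt.clm_bundle_apply
      (F₁ := EuclideanSpace ℝ (Fin k)) (F₂ := EuclideanSpace ℝ (Fin k))
      (E₁ := (TangentSpace (𝓡 k) : N → Type _)) (E₂ := (TangentSpace (𝓡 k) : N → Type _))
      (b := fun y => y) ((S.φ_contMDiff (f x)).mdifferentiableAt (by simp)) hZ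
  have hφrel : ∀ (Z : ∀ y : L, TangentSpace (𝓡 d) y) (Z' : ∀ y : N, TangentSpace (𝓡 k) y),
      (∀ᶠ y in 𝓝 x, Z' (f y) = mfderiv (𝓡 d) (𝓡 k) f y (Z y)) →
      ∀ᶠ y in 𝓝 x, S.φ (f y) (Z' (f y)) = mfderiv (𝓡 d) (𝓡 k) f y (T.φ y (Z y)) := by
    intro Z Z' e
    filter_upwards [e] with y hy
    rw [hT.φ, hy]
  have hηd : ∀ (α : Fin r) (Z : ∀ y : L, TangentSpace (𝓡 d) y)
      (Z' : ∀ y : N, TangentSpace (𝓡 k) y),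
      MDifferentiableAt (𝓡 k) (𝓡 k).tangent
        (fun y => (⟨y, Z' y⟩ : TangentBundle (𝓡 k) N)) (f x) →
      (∀ᶠ y in 𝓝 x, Z' (f y) = mfderiv (𝓡 d) (𝓡 k) f y (Z y)) →
      ∀ v, mvfderiv (𝓡 d) (fun y => T.η α y (Z y)) x v =
        mvfderiv (𝓡 k) (fun y => S.η α y (Z' y)) (f x) (mfderiv (𝓡 d) (𝓡 k) f x v) := by
    intro α Z Z' hZ' e v
    have h1 := MDifferentiableAt.clm_bundle_apply
      (F₁ := EuclideanSpace ℝ (Fin k)) (F₂ := ℝ)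
      (E₁ := (TangentSpace (𝓡 k) : N → Type _)) (E₂ := Bundle.Trivial N ℝ)
      (b := fun y => y) ((S.η_contMDiff α (f x)).mdifferentiableAt (by simp)) hZ'
    have h2 : MDifferentiableAt (𝓡 k) 𝓘(ℝ, ℝ) (fun y => S.η α y (Z' y)) (f x) :=
      ((mdifferentiableAt_totalSpace _ _).1 h1).2
    have h3 : ∀ᶠ y in 𝓝 x, T.η α y (Z y) = (fun z => S.η α z (Z' z)) (f y) := by
      filter_upwards [e] with y hy
      simp only [hT.η, hy]
    rw [mvfderiv_congr h3, mvfderiv_comp_apply' (h := fun z => S.η α z (Z' z)) h2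
      (hf.mdifferentiableAt x)]
  have hd : ∀ α, dOneForm (T.η α) X Y x = dOneForm (S.η α) X' Y' (f x) := by
    intro α
    rw [dOneForm, dOneForm, hηd α Y Y' hY' eY, hηd α X X' hX' eX, hT.η,
      mfderiv_mlieBracket hfs hX hY hX' hY' eX eY, eX.self_of_nhds, eY.self_of_nhds]
  obtain ⟨h1, h2⟩ := hS (f x) X' Y' hX' hY'
  refine ⟨fun α => ?_, ?_⟩
  · rw [hd, h1, hT.inner, hT.φ, eX.self_of_nhds, eY.self_of_nhds]
  -- The derivative of `f` is injective and carries each bracket in the normality tensor to the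
  -- bracket of the extended fields.
  · apply hf.mfderiv_injective x
    rw [map_zero, ← h2]
    simp only [nijenhuis, map_add, map_sub, map_sum, map_smul, hT.φ, hT.ξ, hd]
    rw [mfderiv_mlieBracket hfs hX hY hX' hY' eX eY,
      mfderiv_mlieBracket hfs (hTφ X hX) (hTφ Y hY) (hSφ X' hX') (hSφ Y' hY') (hφrel X X' eX)
        (hφrel Y Y' eY),
      mfderiv_mlieBracket hfs (hTφ X hX) hY (hSφ X' hX') hY' (hφrel X X' eX) eY,
      mfderiv_mlieBracket hfs hX (hTφ Y hY) hX' (hSφ Y' hY') eX (hφrel Y Y' eY)]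

end Restriction

/-! ### Tangent spaces and invariance of `D₀`. -/

section IntegralManifolds

variable {k m d r : ℕ}
  {N : Type*} [TopologicalSpace N] [ChartedSpace (EuclideanSpace ℝ (Fin k)) N]
  [IsManifold (𝓡 k) ∞ N]
  {M : Type*} [TopologicalSpace M] [ChartedSpace (EuclideanSpace ℝ (Fin m)) M]
  {S : MetricGFF k N r} {j : M → N} {Sc : ∀ p : M, Submodule ℝ (TangentSpace (𝓡 m) p)}

/-- The screen contains `ker φ`, and `ξ_α` is orthogonal to the image of `φ` because `η ∘ φ = 0`. -/
lemma IsFrameAt.ξ_mem_map_distD₀ [IsManifold (𝓡 m) ∞ M] {p : M}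
    {E ν : TangentSpace (𝓡 k) (j p)} (h : IsFrameAt S j Sc p E ν)
    (hSc : IsCharacteristicScreen S j Sc) (α : Fin r) :
    S.ξ α (j p) ∈ (distD₀ S j Sc p).map (mfderiv (𝓡 m) (𝓡 k) j p).toLinearMap := by
  have h1 : S.ξ α (j p) ∈ perp₂ (S.bilin (j p)) ⊤ E ν := by
    rw [← h.screen]
    exact hSc.ker_φ p (S.φ_ξ (j p) α)
  have h2 : ∀ v, S.inner (j p) (S.ξ α (j p)) (S.φ (j p) v) = 0 := fun v => by
    rw [S.symm, S.inner_ξ_right, S.η_φ, mul_zero]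
  rw [h.map_distD₀]
  exact mem_perp₂.2 ⟨h1, h2 E, h2 ν⟩

/-- Skewness turns products with `E`, `ν` into products of `v` with `φ E`, `φ ν`. Compatibility
turns products with `φ E`, `φ ν` into products of `v` with `E`, `ν`, without correction since `η`
kills `E` and `ν`. -/
lemma IsFrameAt.φ_mem_map_distD₀ [IsManifold (𝓡 m) ∞ M] {p : M}
    {E ν v : TangentSpace (𝓡 k) (j p)} (h : IsFrameAt S j Sc p E ν)
    (hSc : IsCharacteristicScreen S j Sc)
    (hv : v ∈ (distD₀ S j Sc p).map (mfderiv (𝓡 m) (𝓡 k) j p).toLinearMap) :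
    S.φ (j p) v ∈ (distD₀ S j Sc p).map (mfderiv (𝓡 m) (𝓡 k) j p).toLinearMap := by
  have hξ := h.ξ_mem_map_distD₀ hSc
  simp only [h.map_distD₀, mem_perp₂, Submodule.mem_top, true_and, S.bilin_apply] at hv hξ ⊢
  obtain ⟨⟨h1, h2⟩, h3, h4⟩ := hv
  have hE : ∀ α, S.ε α * S.η α (j p) E = 0 := fun α => by
    rw [← S.inner_ξ_right, S.symm]
    exact (hξ α).1.1
  have hν : ∀ α, S.ε α * S.η α (j p) ν = 0 := fun α => by
    rw [← S.inner_ξ_right, S.symm]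
    exact (hξ α).1.2
  have hsum : ∀ w, (∀ α, S.ε α * S.η α (j p) w = 0) →
      ∑ α, S.ε α * S.η α (j p) v * S.η α (j p) w = 0 := fun w hw =>
    Finset.sum_eq_zero fun α _ => by rw [mul_right_comm, hw, zero_mul]
  refine ⟨⟨?_, ?_⟩, ?_, ?_⟩
  · rw [S.inner_φ_left, h3, neg_zero]
  · rw [S.inner_φ_left, h4, neg_zero]
  · rw [S.compatible, hsum E hE, h1, sub_zero]
  · rw [S.compatible, hsum ν hν, h2, sub_zero]

lemma IsFrameAt.finrank_map_distD₀ {p : M} {E ν : TangentSpace (𝓡 k) (j p)}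
    (h : IsFrameAt S j Sc p E ν) :
    Module.finrank ℝ ((distD₀ S j Sc p).map (mfderiv (𝓡 m) (𝓡 k) j p).toLinearMap) + 4 = k := by
  rw [h.map_distD₀]
  exact (finrank_perp₂_perp₂ (fun v w => S.symm _ v w) h.pair h.pair_map h.mem_left
    h.mem_right).trans (finrank_tangentSpace _)

/-- `ltr (M)` is orthogonal to the distribution `D₀`. -/
lemma IsFrameAt.inner_ltr {p : M} {E ν v w : TangentSpace (𝓡 k) (j p)}
    (h : IsFrameAt S j Sc p E ν) (hv : v ∈ ltr S.toSemiRiemannianMetric j Sc p)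
    (hw : w ∈ (distD₀ S j Sc p).map (mfderiv (𝓡 m) (𝓡 k) j p).toLinearMap) :
    S.inner (j p) v w = 0 := by
  rw [h.ltr_eq, Submodule.mem_span_singleton] at hv
  obtain ⟨c, rfl⟩ := hv
  simp only [h.map_distD₀, mem_perp₂, Submodule.mem_top, true_and, S.bilin_apply] at hw
  rw [S.symm, map_smul, hw.1.2, smul_zero]

/-- The distribution `F` is orthogonal to the distribution `D₀`. -/
lemma IsFrameAt.inner_distF {p : M} {E ν w : TangentSpace (𝓡 k) (j p)}
    (h : IsFrameAt S j Sc p E ν) (hinj : Function.Injective (mfderiv (𝓡 m) (𝓡 k) j p))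
    {v : TangentSpace (𝓡 m) p} (hv : v ∈ distF S j Sc p)
    (hw : w ∈ (distD₀ S j Sc p).map (mfderiv (𝓡 m) (𝓡 k) j p).toLinearMap) :
    S.inner (j p) (mfderiv (𝓡 m) (𝓡 k) j p v) w = 0 := by
  obtain ⟨a, c, t, hact⟩ := (h.mem_distF hinj).1 hv
  simp only [h.map_distD₀, mem_perp₂, Submodule.mem_top, true_and, S.bilin_apply] at hw
  rw [← hact, S.symm]
  simp only [map_add, map_smul, hw.1.1, hw.2.1, hw.2.2, smul_zero, add_zero]

variable [IsManifold (𝓡 m) ∞ M]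
  {L : Type*} [TopologicalSpace L] [ChartedSpace (EuclideanSpace ℝ (Fin d)) L]
  {ι : L → M}

lemma IsIntegralManifold.mfderiv_comp_apply {Δ : ∀ p : M, Submodule ℝ (TangentSpace (𝓡 m) p)}
    (hι : IsIntegralManifold (d := d) Δ ι) (hj : HasRetractions (d := m) (m := k) j) (q : L)
    (v : TangentSpace (𝓡 d) q) :
    mfderiv (𝓡 d) (𝓡 k) (j ∘ ι) q v =
      mfderiv (𝓡 m) (𝓡 k) j (ι q) (mfderiv (𝓡 d) (𝓡 m) ι q v) :=
  _root_.mfderiv_comp_apply q (hj.mdifferentiableAt _)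
    (hι.immersion.contMDiff.contMDiffAt.mdifferentiableAt (by simp)) v

lemma IsIntegralManifold.range_mfderiv_comp {Δ : ∀ p : M, Submodule ℝ (TangentSpace (𝓡 m) p)}
    (hι : IsIntegralManifold (d := d) Δ ι) (hj : HasRetractions (d := m) (m := k) j) (q : L) :
    (mfderiv (𝓡 d) (𝓡 k) (j ∘ ι) q).range =
      (Δ (ι q)).map (mfderiv (𝓡 m) (𝓡 k) j (ι q)).toLinearMap := by
  rw [← hι.range_mfderiv]
  ext v
  constructor
  · rintro ⟨u, rfl⟩
    exact ⟨_, ⟨u, rfl⟩, (hι.mfderiv_comp_apply hj q u).symm⟩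
  · rintro ⟨_, ⟨u, rfl⟩, rfl⟩
    exact ⟨u, hι.mfderiv_comp_apply hj q u⟩

end IntegralManifolds

/-! ### The index of a pulled-back form. -/

section Index

variable {V V' : Type*} [AddCommGroup V] [Module ℝ V] [AddCommGroup V'] [Module ℝ V']

/-- The index of the pullback of a form along an injective map, read off on the range. -/
lemma isIndexOf_pullback {b : LinearMap.BilinForm ℝ V} {A : V' →ₗ[ℝ] V}
    (hA : Function.Injective A) {ν : ℕ}
    (hex : ∃ W ≤ A.range, IsNegOn b W ∧ Module.finrank ℝ W = ν)
    (hmax : ∀ W ≤ A.range, IsNegOn b W → Module.finrank ℝ W ≤ ν) :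
    IsIndexOf (fun v w => b (A v) (A w)) ν := by
  constructor
  · obtain ⟨W, hW, hWn, hWr⟩ := hex
    refine ⟨W.comap A, ?_, fun w hw hw0 => hWn _ hw ((map_ne_zero_iff A hA).2 hw0)⟩
    rw [← finrank_map_of_injOn (q := A) (fun w _ h => (map_eq_zero_iff A hA).1 h),
      Submodule.map_comap_eq_of_le hW, hWr]
  · rintro _ ⟨W, rfl, hWn⟩
    rw [← finrank_map_of_injOn (q := A) (fun w _ h => (map_eq_zero_iff A hA).1 h)]
    refine hmax _ (LinearMap.map_le_range) ?_
    rintro _ ⟨w, hw, rfl⟩ h0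
    exact hWn w hw fun h => h0 (by rw [h, map_zero])

end Index

/-! ### Integral manifolds of `D₀`: dimension, structure and connection. -/

section Restriction

variable {k m d r : ℕ}
  {N : Type*} [TopologicalSpace N] [ChartedSpace (EuclideanSpace ℝ (Fin k)) N]
  [IsManifold (𝓡 k) ∞ N]
  {M : Type*} [TopologicalSpace M] [ChartedSpace (EuclideanSpace ℝ (Fin m)) M]
  [IsManifold (𝓡 m) ∞ M]
  {S : MetricGFF k N r} {j : M → N} {Sc : ∀ p : M, Submodule ℝ (TangentSpace (𝓡 m) p)}
  {L : Type*} [TopologicalSpace L] [ChartedSpace (EuclideanSpace ℝ (Fin d)) L]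
  [IsManifold (𝓡 d) ∞ L] {ι : L → M}

lemma IsIntegralManifold.dim_add_four [Nonempty L]
    (hj : IsCharacteristicHypersurface (m := m) S j) (hSc : IsCharacteristicScreen S j Sc)
    (hι : IsIntegralManifold (d := d) (distD₀ S j Sc) ι) : d + 4 = k := by
  obtain ⟨q⟩ := ‹Nonempty L›
  have hjr := hasRetractions_of_isImmersion hj.immersion
  obtain ⟨E, ν, h⟩ := exists_isFrameAt hj hSc (ι q)
  have h1 := h.finrank_map_distD₀
  rw [← hι.range_mfderiv_comp hjr] at h1
  have h2 := LinearMap.finrank_range_of_inj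
    (f := (mfderiv (𝓡 d) (𝓡 k) (j ∘ ι) q).toLinearMap)
    ((hjr.comp (hasRetractions_of_isImmersion hι.immersion)).mfderiv_injective q)
  rw [finrank_tangentSpace] at h2
  rw [← h1]
  exact congrArg (· + 4) h2.symm

/-- An integral manifold of `D₀` inherits a metric g.f.f-structure whose index is less by two. -/
lemma IsIntegralManifold.exists_isRestriction [Nonempty L]
    (hj : IsCharacteristicHypersurface (m := m) S j) (hSc : IsCharacteristicScreen S j Sc)
    (hι : IsIntegralManifold (d := d) (distD₀ S j Sc) ι) (hr : r < d) :
    ∃ T : MetricGFF d L r, IsRestriction (j ∘ ι) S T ∧ T.index + 2 = S.index := by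
  have hjr := hasRetractions_of_isImmersion hj.immersion
  have hf := hjr.comp (hasRetractions_of_isImmersion hι.immersion)
  have hrange := hι.range_mfderiv_comp (k := k) hjr
  have hindex : ∀ q : L, (∃ W ≤ (mfderiv (𝓡 d) (𝓡 k) (j ∘ ι) q).range,
      IsNegOn (S.bilin (j (ι q))) W ∧ Module.finrank ℝ W + 2 = S.index) ∧
      ∀ W ≤ (mfderiv (𝓡 d) (𝓡 k) (j ∘ ι) q).range, IsNegOn (S.bilin (j (ι q))) W →
        Module.finrank ℝ W + 2 ≤ S.index := by
    intro q
    obtain ⟨E, ν, h⟩ := exists_isFrameAt hj hSc (ι q)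
    rw [hrange, h.map_distD₀]
    exact index_perp₂_perp₂ (fun v w => S.symm _ v w) h.pair h.pair_map h.mem_left h.mem_right
      (S.isIndexOf _)
  -- This makes the truncated subtraction `S.index - 2` a genuine one.
  have h2 : 2 ≤ S.index := by
    obtain ⟨q⟩ := ‹Nonempty L›
    obtain ⟨⟨W, -, -, hW⟩, -⟩ := hindex q
    omega
  suffices ∃ T : MetricGFF d L r, IsRestriction (j ∘ ι) S T ∧ T.index = S.index - 2 by
    obtain ⟨T, hT, hTν⟩ := this
    exact ⟨T, hT, by omega⟩
  refine hf.exists_isRestriction S hr (fun q v => ?_) (fun α q => ?_) (fun q v hv => ?_) _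
    (fun q => ?_)
  · obtain ⟨E, ν, h⟩ := exists_isFrameAt hj hSc (ι q)
    have h1 := h.φ_mem_map_distD₀ hSc ((hrange q).le ⟨v, rfl⟩)
    rw [← hrange] at h1
    exact h1
  · obtain ⟨E, ν, h⟩ := exists_isFrameAt hj hSc (ι q)
    have h1 := h.ξ_mem_map_distD₀ hSc α
    rw [← hrange] at h1
    exact h1
  · obtain ⟨E, ν, h⟩ := exists_isFrameAt hj hSc (ι q)
    have hP := (hrange q).trans h.map_distD₀
    apply hf.mfderiv_injective q
    rw [map_zero]
    refine nondegenerate_perp₂_perp₂ (b := S.bilin (j (ι q))) (fun v w => S.symm _ v w) h.pair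
      h.pair_map h.mem_left h.mem_right (fun v h => S.nondegenerate _ v h)
      (hP ▸ LinearMap.mem_range_self _ v) fun w hw => ?_
    obtain ⟨u, rfl⟩ := hP.ge hw
    exact hv u
  · obtain ⟨⟨W, hW, hWn, hWr⟩, hmax⟩ := hindex q
    exact isIndexOf_pullback (b := S.bilin (j (ι q)))
      (A := (mfderiv (𝓡 d) (𝓡 k) (j ∘ ι) q).toLinearMap) (hf.mfderiv_injective q)
      ⟨W, hW, hWn, Nat.eq_sub_of_add_eq hWr⟩ fun W hW hWn => Nat.le_sub_of_add_le (hmax W hW hWn)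

/-- The connection induced on an integral manifold of `D₀` is its Levi-Civita connection. -/
lemma IsIntegralManifold.isLeviCivita
    (hj : IsCharacteristicHypersurface (m := m) S j) (hSc : IsCharacteristicScreen S j Sc)
    (hι : IsIntegralManifold (d := d) (distD₀ S j Sc) ι) {T : MetricGFF d L r}
    (hT : IsRestriction (j ∘ ι) S T)
    {covN : CovariantDerivative (𝓡 k) (EuclideanSpace ℝ (Fin k)) (TangentSpace (𝓡 k) : N → Type _)}
    (hN : IsLeviCivita S.toSemiRiemannianMetric covN)
    {covM : CovariantDerivative (𝓡 m) (EuclideanSpace ℝ (Fin m)) (TangentSpace (𝓡 m) : M → Type _)}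
    (hM : IsInducedConnection j (ltr S.toSemiRiemannianMetric j Sc) covN covM)
    {covL : CovariantDerivative (𝓡 d) (EuclideanSpace ℝ (Fin d)) (TangentSpace (𝓡 d) : L → Type _)}
    (hL : IsInducedConnection ι (fun q => distF S j Sc (ι q)) covM covL) :
    IsLeviCivita T.toSemiRiemannianMetric covL := by
  have hjr := hasRetractions_of_isImmersion hj.immersion
  have hιr := hasRetractions_of_isImmersion hι.immersion
  have hcomp := hι.mfderiv_comp_apply (k := k) hjr
  refine (hjr.comp hιr).isLeviCivita S.toSemiRiemannianMetric _ hT.inner hN covL fun q Y hY => ?_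
  obtain ⟨Y', hY', eY'⟩ := hιr.exists_extension hY
  obtain ⟨Z, hZ, eZ⟩ := hjr.exists_extension hY'
  refine ⟨Z, hZ, ?_, fun v w => ?_⟩
  · filter_upwards [eY', hιr.contMDiff.continuous.continuousAt.eventually eZ] with y h1 h2
    rw [hcomp, ← h1]
    exact h2
  · obtain ⟨E, ν, h⟩ := exists_isFrameAt hj hSc (ι q)
    have hw : mfderiv (𝓡 d) (𝓡 k) (j ∘ ι) q w ∈
        (distD₀ S j Sc (ι q)).map (mfderiv (𝓡 m) (𝓡 k) j (ι q)).toLinearMap := by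
      rw [← hι.range_mfderiv_comp hjr]
      exact ⟨w, rfl⟩
    -- The two second fundamental forms take values in `ltr (M)` and `F`, both orthogonal to the
    -- tangent space of `L`, so pairing with `w` does not see them.
    have h1 := h.inner_ltr (hM (ι q) Y' Z hY' hZ eZ (mfderiv (𝓡 d) (𝓡 m) ι q v)) hw
    have h2 := h.inner_distF (hjr.mfderiv_injective _) (hL q Y Y' hY hY' eY' v) hw
    rw [map_sub, sub_apply, sub_eq_zero] at h1
    rw [map_sub, map_sub, sub_apply, sub_eq_zero] at h2
    rw [hT.inner, hcomp q v, hcomp q (covL Y q v)]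
    exact h1.trans h2

end Restriction

end LightlikeGFF

end

/-- Let `(N, φ, ξ_α, η^α, g)` be an indefinite `S`-manifold of dimension `2 n + r`, `n ≥ 3`, and
`j : M → N` a characteristic lightlike hypersurface with a characteristic screen distribution `Sc`
such that `D₀` is integrable. Every integral manifold `L` of `D₀`, in particular every leaf, has
dimension `2 (n - 2) + r`, and the restrictions of `g, φ, ξ_α, η^α` form a metric `S`-structure
on `L`, of index two less than the index of `g`; so it is an indefinite one unless the restriction
of `g` to `L` is definite. If `covN` is the Levi-Civita connection of `N`, then the induced
connection `covM` on `M` and the connection `covL` that `covM` induces on `L` through the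
decomposition `TM = D₀ ⊥ F` exist, and `covL` is the Levi-Civita connection of `L`. -/
theorem mainTheorem3
    (n r m d : ℕ) (hn : 3 ≤ n)
    (N : Type*) [TopologicalSpace N] [T2Space N]
    [ChartedSpace (EuclideanSpace ℝ (Fin (2 * n + r))) N] [IsManifold (𝓡 (2 * n + r)) ∞ N]
    (S : LightlikeGFF.MetricGFF (2 * n + r) N r) (hS : S.IsIndefiniteSStructure)
    (M : Type*) [TopologicalSpace M] [T2Space M]
    [ChartedSpace (EuclideanSpace ℝ (Fin m)) M] [IsManifold (𝓡 m) ∞ M]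
    (j : M → N) (hj : LightlikeGFF.IsCharacteristicHypersurface (m := m) S j)
    (Sc : ∀ p : M, Submodule ℝ (TangentSpace (𝓡 m) p))
    (hSc : LightlikeGFF.IsCharacteristicScreen S j Sc)
    (hD₀ : LightlikeGFF.IsIntegrable (LightlikeGFF.distD₀ S j Sc))
    (L : Type*) [Nonempty L] [TopologicalSpace L] [T2Space L]
    [ChartedSpace (EuclideanSpace ℝ (Fin d)) L] [IsManifold (𝓡 d) ∞ L]
    (ι : L → M)
    (hι : LightlikeGFF.IsIntegralManifold (d := d) (LightlikeGFF.distD₀ S j Sc) ι) :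
    d = 2 * (n - 2) + r ∧
    ∃ T : LightlikeGFF.MetricGFF d L r,
      LightlikeGFF.IsRestriction (j ∘ ι) S T ∧
      T.IsSStructure ∧
      T.index + 2 = S.index ∧
      (T.IsIndefiniteSStructure ↔ 2 < S.index ∧ S.index + 2 < 2 * n + r) ∧
      ∀ covN : CovariantDerivative (𝓡 (2 * n + r)) (EuclideanSpace ℝ (Fin (2 * n + r)))
          (TangentSpace (𝓡 (2 * n + r)) : N → Type _),
        LightlikeGFF.IsLeviCivita S.toSemiRiemannianMetric covN →
        (∃ covM : CovariantDerivative (𝓡 m) (EuclideanSpace ℝ (Fin m))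
            (TangentSpace (𝓡 m) : M → Type _),
          LightlikeGFF.IsInducedConnection j
            (LightlikeGFF.ltr S.toSemiRiemannianMetric j Sc) covN covM) ∧
        ∀ covM : CovariantDerivative (𝓡 m) (EuclideanSpace ℝ (Fin m))
            (TangentSpace (𝓡 m) : M → Type _),
          LightlikeGFF.IsInducedConnection j
            (LightlikeGFF.ltr S.toSemiRiemannianMetric j Sc) covN covM →
          (∃ covL : CovariantDerivative (𝓡 d) (EuclideanSpace ℝ (Fin d))
              (TangentSpace (𝓡 d) : L → Type _),
            LightlikeGFF.IsInducedConnection ι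
              (fun q => LightlikeGFF.distF S j Sc (ι q)) covM covL) ∧
          ∀ covL : CovariantDerivative (𝓡 d) (EuclideanSpace ℝ (Fin d))
              (TangentSpace (𝓡 d) : L → Type _),
            LightlikeGFF.IsInducedConnection ι
              (fun q => LightlikeGFF.distF S j Sc (ι q)) covM covL →
            LightlikeGFF.IsLeviCivita T.toSemiRiemannianMetric covL := by
  have hdim := hι.dim_add_four hj hSc
  have hd : d = 2 * (n - 2) + r := by omega
  -- The bound `n ≥ 3` gives `r < d`, which keeps the restricted `φ` from vanishing.
  obtain ⟨T, hT, hTν⟩ := hι.exists_isRestriction hj hSc (by omega)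
  have hjr := LightlikeGFF.hasRetractions_of_isImmersion hj.immersion
  have hιr := LightlikeGFF.hasRetractions_of_isImmersion hι.immersion
  have hTS := hT.isSStructure (hjr.comp hιr) hS.2
  refine ⟨hd, T, hT, hTS, hTν, ?_, fun covN hN => ⟨?_, fun covM hM => ⟨?_, fun covL hL =>
    hι.isLeviCivita hj hSc hT hN hM hL⟩⟩⟩
  · simp only [LightlikeGFF.MetricGFF.IsIndefiniteSStructure,
      LightlikeGFF.MetricGFF.IsIndefinite, hTS, and_true]
    omega
  · refine hjr.exists_isInducedConnection _ (fun p => ?_) covN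
    obtain ⟨E, ν, h⟩ := LightlikeGFF.exists_isFrameAt hj hSc p
    exact h.isCompl_ltr
  · refine hιr.exists_isInducedConnection _ (fun q => ?_) covM
    obtain ⟨E, ν, h⟩ := LightlikeGFF.exists_isFrameAt hj hSc (ι q)
    rw [hι.range_mfderiv]
    exact h.isCompl_distF (hjr.mfderiv_injective _)
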